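/- Let $\mathrm{RC}(T)$ be the Boolean algebra of regular closed subsets of a topological space $T$ (sets $X$ equal to the closure of their interior), with $X+Y=X\cup Y$, $X\cdot Y=\overline{(X\cap Y)^\circ}$, $-X=\overline{T\setminus X}$, $0=\emptyset$, $1=T$. Let $\mathrm{RCP}(\mathbb R^n)$ be the Boolean subalgebra of $\mathrm{RC}(\mathbb R^n)$ generated by the closed half-spaces. The language $\mathcal{B}c$ consists of all Boolean combinations of atoms $\tau_1=\tau_2$ and $c(\tau)$, where $\tau,\tau_1,\tau_2$ are terms built from countably many variables with $+,\cdot,-,0,1$. Under an assignment of elements of a Boolean subalgebra $S$ of $\mathrm{RC}(T)$ to the variables, $c(\tau)$ says that the value of $\tau$ is a connected set (the empty set counts as connected). $\mathrm{Sat}(\mathcal{B}c,S)$ is the set of $\mathcal{B}c$-formulas made true by some assignment of elements of $S$. A space $T$ is unicoherent if $X_1\cap X_2$ is connected for all closed connected $X_1,X_2$ with $X_1\cup X_2=T$ (the empty set again counting as connected). Write $\mathrm{notC}(\tau_1,\tau_2)$ for $c(\tau_1)\wedge c(\tau_2)\wedge\neg c(\tau_1+\tau_2)$, and $\tau_1\le\tau_2$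 for $\tau_1\cdot\tau_2=\tau_1$. Let $\phi^c_\infty$ be the $\mathcal{B}c$-formula in the $18$ variables $r_i,r_i',s_i,t_i$ ($0\le i\le 3$), $s$, $t$ which is the conjunction of the following formulas, where the indices of variables are taken modulo $4$ and $d_i=r_i\cdot(-r_i')$: 1. $r_0+r_1+r_2+r_3=1$; $r_i\cdot r_j=0$ for $0\le i<j\le 3$; $r_i\neq 0$ for $0\le i\le 3$; 2. for $i=0,1$: $\mathrm{notC}(r_i'+s_i,\ r_{i+2}'+s_{i+2})$, $\mathrm{notC}(d_i+t_i,\ d_{i+2}+t_{i+2})$, $\mathrm{notC}(d_i+t,\ r_{i+2}'+s)$ and $\mathrm{notC}(r_i'+s,\ d_{i+2}+t)$; 3. $r_i'\neq 0$ and $r_i'\le r_i$ for $0\le i\le 3$; $t\neq 0$; 4. $c(r_i'+r_{i+1}+t)$ for $0\le i\le 3$; 5. $\mathrm{notC}(r_0'+r_1'+r_2'+r_3',\ t)$; 6. $\mathrm{notC}(r_i'+s,\ d_{i+1}+t)$ for $0\le i\le 3$. Theorem. (a) For every $n\ge 2$, $\phi^c_\infty$ is satisfiable over $\mathrm{RC}(\mathbb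 R^n)$. (b) If $T$ is a locally connected, unicoherent space, then every tuple of elements of $\mathrm{RC}(T)$ that satisfies $\phi^c_\infty$ has a member with infinitely many connected components. (c) Consequently $\mathrm{Sat}(\mathcal{B}c,\mathrm{RC}(\mathbb R^n))\neq\mathrm{Sat}(\mathcal{B}c,\mathrm{RCP}(\mathbb R^n))$ for every $n\ge 2$. -/

import Mathlib

namespace BcLogic

/-! ### The Boolean algebra of regular closed sets -/

/-- A regular closed subset of a topological space: a set equal to the closure of its interior. -/
@[ext]
structure RC (T : Type*) [TopologicalSpace T] where
  /-- the underlying set of points -/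
  carrier : Set T
  closure_interior' : closure (interior carrier) = carrier

namespace RC

variable {T : Type*} [TopologicalSpace T]

theorem isClosed (a : RC T) : IsClosed a.carrier := by
  rw [← a.closure_interior']; exact isClosed_closure

theorem carrier_injective : Function.Injective (RC.carrier : RC T → Set T) :=
  fun _ _ h => RC.ext h

/-- The closure of an open set is regular closed. -/
theorem closure_interior_closure_of_isOpen {U : Set T} (hU : IsOpen U) :
    closure (interior (closure U)) = closure U := by
  apply Set.Subset.antisymm
  · exact closure_minimal interior_subset isClosed_closure
  · exact closure_mono (interior_maximal subset_closure hU)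

/-- The order is inclusion. -/
instance : PartialOrder (RC T) := PartialOrder.lift RC.carrier carrier_injective

/-- The sum is the union. -/
instance : Max (RC T) where
  max a b := ⟨a.carrier ∪ b.carrier, by
    apply Set.Subset.antisymm
    · exact closure_minimal interior_subset (a.isClosed.union b.isClosed)
    · apply Set.union_subset
      · conv_lhs => rw [← a.closure_interior']
        exact closure_mono (interior_mono Set.subset_union_left)
      · conv_lhs => rw [← b.closure_interior']
        exact closure_mono (interior_mono Set.subset_union_right)⟩

/-- The product is the closure of the interior of the intersection. -/
instance : Min (RC T) where
  min a b := ⟨closure (interior (a.carrier ∩ b.carrier)),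
    closure_interior_closure_of_isOpen isOpen_interior⟩

/-- The complement is the closure of the set-theoretic complement. -/
instance : Compl (RC T) where
  compl a := ⟨closure a.carrierᶜ, closure_interior_closure_of_isOpen a.isClosed.isOpen_compl⟩

instance : Top (RC T) where
  top := ⟨Set.univ, by simp⟩

instance : Bot (RC T) where
  bot := ⟨∅, by simp⟩

theorem inf_subset (a b : RC T) : (a ⊓ b).carrier ⊆ a.carrier ∩ b.carrier :=
  closure_minimal interior_subset (a.isClosed.inter b.isClosed)

instance : Lattice (RC T) where
  sup := max
  inf := min
  le_sup_left _ _ := Set.subset_union_left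
  le_sup_right _ _ := Set.subset_union_right
  sup_le _ _ _ h₁ h₂ := Set.union_subset h₁ h₂
  inf_le_left a b := (inf_subset a b).trans Set.inter_subset_left
  inf_le_right a b := (inf_subset a b).trans Set.inter_subset_right
  le_inf a b c h₁ h₂ := by
    change a.carrier ⊆ closure (interior (b.carrier ∩ c.carrier))
    conv_lhs => rw [← a.closure_interior']
    exact closure_mono (interior_mono (Set.subset_inter h₁ h₂))

instance : DistribLattice (RC T) where
  le_sup_inf a b c := by
    change closure (interior ((a.carrier ∪ b.carrier) ∩ (a.carrier ∪ c.carrier))) ⊆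
      a.carrier ∪ closure (interior (b.carrier ∩ c.carrier))
    refine closure_minimal ?_ (a.isClosed.union isClosed_closure)
    rw [← Set.union_inter_distrib_left]
    intro x hx
    by_cases hxa : x ∈ a.carrier
    · exact Or.inl hxa
    · refine Or.inr (subset_closure ?_)
      refine mem_interior.2 ⟨interior (a.carrier ∪ b.carrier ∩ c.carrier) ∩ a.carrierᶜ, ?_,
        isOpen_interior.inter a.isClosed.isOpen_compl, hx, hxa⟩
      rintro y ⟨hy, hya⟩
      exact (interior_subset hy).resolve_left hya

/-- The regular closed sets form a Boolean algebra. -/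
instance : BooleanAlgebra (RC T) where
  le_top _ := Set.subset_univ _
  bot_le _ := Set.empty_subset _
  inf_compl_le_bot a := by
    change closure (interior (a.carrier ∩ closure a.carrierᶜ)) ⊆ ∅
    have h : interior (a.carrier ∩ closure a.carrierᶜ) = ∅ := by
      rw [interior_inter, closure_compl, Set.eq_empty_iff_forall_notMem]
      rintro x ⟨hx, hx'⟩
      exact interior_subset hx' hx
    rw [h, closure_empty]
  top_le_sup_compl a := by
    change Set.univ ⊆ a.carrier ∪ closure a.carrierᶜ
    intro x _
    by_cases hx : x ∈ a.carrier
    · exact Or.inl hx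
    · exact Or.inr (subset_closure hx)

end RC

/-! ### Regular closed polyhedra -/

/-- The closed half-spaces of `ℝⁿ`, as regular closed sets: the sets `{x | ⟪a, x⟫ ≤ b}`, `a ≠ 0`. -/
def halfSpaces (n : ℕ) : Set (RC (EuclideanSpace ℝ (Fin n))) :=
  {H | ∃ (a : EuclideanSpace ℝ (Fin n)) (b : ℝ), a ≠ 0 ∧ H.carrier = {x | inner ℝ a x ≤ b}}

/-- The Boolean subalgebra of `RC(ℝⁿ)` generated by the half-spaces. -/
def RCP (n : ℕ) : BooleanSubalgebra (RC (EuclideanSpace ℝ (Fin n))) :=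
  BooleanSubalgebra.closure (halfSpaces n)

/-! ### Unicoherence -/

/-- A space is unicoherent if any two closed connected sets that cover it have a connected
intersection. The empty set counts as connected. -/
def Unicoherent (T : Type*) [TopologicalSpace T] : Prop :=
  ∀ X Y : Set T, IsClosed X → IsClosed Y → IsPreconnected X → IsPreconnected Y →
    X ∪ Y = Set.univ → IsPreconnected (X ∩ Y)

/-! ### The language `Bc` -/

/-- Boolean terms over the variables `0, 1, 2, …`. -/
inductive Term : Type
  | var (v : ℕ) : Term
  | add (τ₁ τ₂ : Term) : Term
  | mul (τ₁ τ₂ : Term) : Term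
  | neg (τ : Term) : Term
  | zero : Term
  | one : Term

/-- Formulas of `Bc`: Boolean combinations of equations of terms and of atoms `c(τ)`. -/
inductive Formula : Type
  | eq (τ₁ τ₂ : Term) : Formula
  | conn (τ : Term) : Formula
  | or (φ₁ φ₂ : Formula) : Formula
  | and (φ₁ φ₂ : Formula) : Formula
  | not (φ : Formula) : Formula

/-- The variables of a term. -/
def Term.vars : Term → Finset ℕ
  | .var v => {v}
  | .add τ₁ τ₂ => τ₁.vars ∪ τ₂.vars
  | .mul τ₁ τ₂ => τ₁.vars ∪ τ₂.vars
  | .neg τ => τ.vars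
  | .zero => ∅
  | .one => ∅

/-- The variables of a formula. -/
def Formula.vars : Formula → Finset ℕ
  | .eq τ₁ τ₂ => τ₁.vars ∪ τ₂.vars
  | .conn τ => τ.vars
  | .or φ₁ φ₂ => φ₁.vars ∪ φ₂.vars
  | .and φ₁ φ₂ => φ₁.vars ∪ φ₂.vars
  | .not φ => φ.vars

section Semantics

variable {T : Type*} [TopologicalSpace T]

/-- The value of a term under an assignment of regular closed sets to the variables. -/
def Term.eval (I : ℕ → RC T) : Term → RC T
  | .var v => I v
  | .add τ₁ τ₂ => τ₁.eval I ⊔ τ₂.eval I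
  | .mul τ₁ τ₂ => τ₁.eval I ⊓ τ₂.eval I
  | .neg τ => (τ.eval I)ᶜ
  | .zero => ⊥
  | .one => ⊤

/-- Truth of a formula under an assignment; `c(τ)` says that the value of `τ` is connected,
the empty set being counted as connected. -/
def Formula.Holds (I : ℕ → RC T) : Formula → Prop
  | .eq τ₁ τ₂ => τ₁.eval I = τ₂.eval I
  | .conn τ => IsPreconnected (τ.eval I).carrier
  | .or φ₁ φ₂ => φ₁.Holds I ∨ φ₂.Holds I
  | .and φ₁ φ₂ => φ₁.Holds I ∧ φ₂.Holds I
  | .not φ => ¬ φ.Holds I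

/-- `Sat(Bc, {(T, S)})`: the set of formulas satisfied by some interpretation over the frame
`(T, S)`, that is, by some assignment of elements of `S` to the variables. -/
def Sat (S : BooleanSubalgebra (RC T)) : Set Formula :=
  {φ | ∃ I : ℕ → RC T, (∀ v, I v ∈ S) ∧ φ.Holds I}

end Semantics

/-! ### The formula `φ^c_∞` -/

/-- Finite conjunctions. -/
def conj : List Formula → Formula
  | [] => .eq .one .one
  | [φ] => φ
  | φ :: ψ :: l => .and φ (conj (ψ :: l))

/-- `⋀_{0 ≤ i < 4} φ i` -/
def conj4 (φ : Fin 4 → Formula) : Formula := conj [φ 0, φ 1, φ 2, φ 3]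

/-- `τ₀ + τ₁ + τ₂ + τ₃` -/
def sum4 (τ : Fin 4 → Term) : Term := .add (.add (.add (τ 0) (τ 1)) (τ 2)) (τ 3)

/-- `τ ≠ 0` -/
def nonzero (τ : Term) : Formula := .not (.eq τ .zero)

/-- `τ₁ ≤ τ₂`, written as `τ₁ · τ₂ = τ₁` -/
def le (τ₁ τ₂ : Term) : Formula := .eq (.mul τ₁ τ₂) τ₁

/-- `notC(τ₁, τ₂) = c(τ₁) ∧ c(τ₂) ∧ ¬ c(τ₁ + τ₂)` -/
def notC (τ₁ τ₂ : Term) : Formula :=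
  conj [.conn τ₁, .conn τ₂, .not (.conn (.add τ₁ τ₂))]

/-- the variables `r₀, …, r₃` -/
def r (i : Fin 4) : Term := .var i.val

/-- the variables `r'₀, …, r'₃` -/
def r' (i : Fin 4) : Term := .var (4 + i.val)

/-- the variable `t` -/
def t : Term := .var 8

/-- the variable `s` -/
def s : Term := .var 9

/-- the variables `s₀, …, s₃` -/
def sv (i : Fin 4) : Term := .var (10 + i.val)

/-- the variables `t₀, …, t₃` -/
def tv (i : Fin 4) : Term := .var (14 + i.val)

/-- the term `rᵢ · (-r'ᵢ)` -/
def d (i : Fin 4) : Term := .mul (r i) (.neg (r' i))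

/-- `r₀, …, r₃` is a partition into non-empty regions. -/
def partitionPart : Formula :=
  conj [.eq (sum4 r) .one,
    .eq (.mul (r 0) (r 1)) .zero, .eq (.mul (r 0) (r 2)) .zero, .eq (.mul (r 0) (r 3)) .zero,
    .eq (.mul (r 1) (r 2)) .zero, .eq (.mul (r 1) (r 3)) .zero, .eq (.mul (r 2) (r 3)) .zero,
    conj4 fun i => nonzero (r i)]

/-- The conjuncts that replace `¬ C(rᵢ, rᵢ₊₂)`. -/
def separationPart (i : Fin 4) : Formula :=
  conj [notC (.add (r' i) (sv i)) (.add (r' (i + 2)) (sv (i + 2))),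
    notC (.add (d i) (tv i)) (.add (d (i + 2)) (tv (i + 2))),
    notC (.add (d i) t) (.add (r' (i + 2)) s),
    notC (.add (r' i) s) (.add (d (i + 2)) t)]

/-- The `Bc`-formula `φ^c_∞`; the addition of indices in `Fin 4` is modulo `4`. -/
def phiInfty : Formula :=
  conj [partitionPart,
    separationPart 0, separationPart 1,
    conj4 fun i => .and (nonzero (r' i)) (le (r' i) (r i)),
    nonzero t,
    conj4 fun i => .conn (.add (.add (r' i) (r (i + 1))) t),
    notC (sum4 r') t,
    conj4 fun i => notC (.add (r' i) s) (.add (d (i + 1)) t)]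

end BcLogic

/-! Two connected sets with a common point have a connected union, so `notC` forces its two
arguments to be disjoint; the sets `s`, `sᵢ`, `tᵢ` serve only to make the arguments connected. The
formula thus says that opposite `rᵢ` are disjoint and that `r'ᵢ` misses `dᵢ₊₁` and `t`.

For (b), suppose that all the `rᵢ` and `r'ᵢ` have finitely many components. Since `r'ᵢ + rᵢ₊₁ + t`
is connected, every component of `r'ᵢ` must touch `rᵢ₊₁`, and it can do so only in `r'ᵢ₊₁`. This
yields an endless walk `X₀, X₁, …`, where `Xₖ` is a component of `rₖ` (index mod 4) and meets
`Xₖ₊₁`. Let `Dₖ` be the component of the complement of `Xₖ₊₂` that contains `Xₖ`. By unicoherence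
its frontier is connected (`Unicoherent.isPreconnected_frontier`), hence lies in just one of the
disjoint neighbours `rₖ₊₁`, `rₖ₊₃` of `rₖ₊₂`, namely `rₖ₊₁`, which `Xₖ₊₁` makes it meet. So `Xₖ₊₃`
cannot enter `Dₖ`, the `Dₖ` increase, and the walk never returns: `X₀, X₄, X₈, …` are distinct
components of `r₀` (`Unicoherent.false_of_walk`).

For (a), the plane is cut into concentric square shells, numbered mod 4 to give the `rᵢ`; `dᵢ` is
made of the left sides and `r'ᵢ` of the other three. Preimages under a coordinate projection carry
this to `ℝⁿ`.

For (c), `ℝⁿ` is unicoherent by lifting circle-valued maps (`unicoherent_of_simplyConnected`), and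
polyhedra are finite unions of convex sets, hence have finitely many components, so (b) excludes
them. -/

namespace BcLogic

open Set Topology

/-! ### Components, frontiers and walks in unicoherent spaces -/

section Connectedness

variable {T : Type*} [TopologicalSpace T]

/-- A preconnected set stays preconnected when preconnected sets meeting it are attached. -/
theorem isPreconnected_union_iUnion {ι : Sort*} {B : Set T} {A : ι → Set T}
    (hB : IsPreconnected B) (hA : ∀ i, IsPreconnected (A i)) (h : ∀ i, (A i ∩ B).Nonempty) :
    IsPreconnected (B ∪ ⋃ i, A i) := by
  rcases B.eq_empty_or_nonempty with rfl | ⟨x, hx⟩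
  · have : IsEmpty ι := ⟨fun i => by simpa using h i⟩
    simpa using isPreconnected_empty
  · have e : B ∪ ⋃ i, A i = ⋃₀ insert B (range fun i => B ∪ A i) := by
      ext y
      simp only [mem_union, mem_iUnion, sUnion_insert, sUnion_range]
      constructor
      · rintro (hy | ⟨i, hy⟩)
        exacts [Or.inl hy, Or.inr ⟨i, Or.inr hy⟩]
      · rintro (hy | ⟨i, hy | hy⟩)
        exacts [Or.inl hy, Or.inl hy, Or.inr ⟨i, hy⟩]
    rw [e]
    refine isPreconnected_sUnion x _ ?_ ?_
    · rintro s (rfl | ⟨i, rfl⟩)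
      exacts [hx, Or.inl hx]
    · rintro s (rfl | ⟨i, rfl⟩)
      exacts [hB, hB.union' (by rw [inter_comm]; exact h i) (hA i)]

theorem not_isPreconnected_union_of_disjoint {A B : Set T} (hA : IsClosed A) (hB : IsClosed B)
    (hA' : A.Nonempty) (hB' : B.Nonempty) (h : Disjoint A B) : ¬ IsPreconnected (A ∪ B) := by
  intro hc
  obtain ⟨x, -, hxA, hxB⟩ := isPreconnected_closed_iff.1 hc A B hA hB subset_rfl
    (hA'.mono fun x hx => ⟨Or.inl hx, hx⟩) (hB'.mono fun x hx => ⟨Or.inr hx, hx⟩)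
  exact h.le_bot ⟨hxA, hxB⟩

theorem isClosed_connectedComponentIn {A : Set T} (hA : IsClosed A) (x : T) :
    IsClosed (connectedComponentIn A x) := by
  by_cases hx : x ∈ A
  · refine isClosed_of_closure_subset ?_
    exact isPreconnected_connectedComponentIn.closure.subset_connectedComponentIn
      (subset_closure (mem_connectedComponentIn hx))
      (closure_minimal (connectedComponentIn_subset _ _) hA)
  · simp [connectedComponentIn_eq_empty hx]

/-- The complement of a component of a closed set with finitely many components is closed. -/
theorem isClosed_diff_connectedComponentIn {A : Set T} (hA : IsClosed A)
    [Finite (ConnectedComponents A)] (x : T) : IsClosed (A \ connectedComponentIn A x) := by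
  by_cases hx : x ∈ A
  · have h : IsOpen (connectedComponent (⟨x, hx⟩ : A)) :=
      ConnectedComponents.discreteTopology_iff.1 inferInstance _
    have h2 := hA.isClosedEmbedding_subtypeVal.isClosedMap _ h.isClosed_compl
    convert h2 using 1
    rw [connectedComponentIn_eq_image hx, image_compl_eq_range_sdiff_image Subtype.val_injective,
      Subtype.range_coe]
  · simpa [connectedComponentIn_eq_empty hx] using hA

theorem inter_frontier_nonempty {A C : Set T} (hA : IsPreconnected A)
    (h : (A ∩ C).Nonempty) (h' : (A ∩ Cᶜ).Nonempty) : (A ∩ frontier C).Nonempty := by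
  by_contra hne
  rw [not_nonempty_iff_eq_empty] at hne
  have hcov : A ⊆ interior C ∪ (closure C)ᶜ := by
    intro y hy
    by_cases hyi : y ∈ interior C
    · exact Or.inl hyi
    · refine Or.inr fun hyc => ?_
      have : y ∈ A ∩ frontier C := ⟨hy, hyc, hyi⟩
      rw [hne] at this
      exact this
  obtain ⟨x, hxA, hxC⟩ := h
  obtain ⟨z, hzA, hzC⟩ := h'
  obtain ⟨w, -, hw, hw'⟩ := hA _ _ isOpen_interior isClosed_closure.isOpen_compl hcov
    ⟨x, hxA, (hcov hxA).resolve_right fun h => h (subset_closure hxC)⟩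
    ⟨z, hzA, (hcov hzA).resolve_left fun h => hzC (interior_subset h)⟩
  exact hw' (subset_closure (interior_subset hw))

/-- Components of the open set `Xᶜ` are open by local connectedness, so a frontier point outside `X`
would have its own component as a neighbourhood, and the two components would coincide. -/
theorem frontier_connectedComponentIn_compl_subset [LocallyConnectedSpace T] {X : Set T}
    (hX : IsClosed X) (y : T) : frontier (connectedComponentIn Xᶜ y) ⊆ X := by
  intro p hp
  by_contra hpX
  have ho : IsOpen (connectedComponentIn Xᶜ p) := hX.isOpen_compl.connectedComponentIn
  obtain ⟨z, hz, hz'⟩ := mem_closure_iff.1 hp.1 _ ho (mem_connectedComponentIn hpX)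
  have e := (connectedComponentIn_eq hz).trans (connectedComponentIn_eq hz').symm
  rw [← e] at hp
  exact hp.2 (ho.interior_eq.symm ▸ mem_connectedComponentIn hpX)

/-- In a connected, locally connected, unicoherent space the components of the complement of a
closed connected set have connected frontiers. -/
theorem Unicoherent.isPreconnected_frontier [LocallyConnectedSpace T] [PreconnectedSpace T]
    (hT : Unicoherent T) {X : Set T} (hX : IsClosed X) (hXc : IsPreconnected X)
    (hXne : X.Nonempty) (y : T) : IsPreconnected (frontier (connectedComponentIn Xᶜ y)) := by
  have hopen : ∀ z, IsOpen (connectedComponentIn Xᶜ z) := fun z =>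
    hX.isOpen_compl.connectedComponentIn
  set C := connectedComponentIn Xᶜ y with hC
  -- The complement of `C` is `X` with the closures of the other components attached. Each closure
  -- touches `X` along its frontier, so `Cᶜ` is connected, and unicoherence applies to `closure C`
  -- and `Cᶜ`.
  have hcompl : Cᶜ = X ∪ ⋃ z : {z // z ∉ X ∧ z ∉ C}, closure (connectedComponentIn Xᶜ z) := by
    apply Subset.antisymm
    · intro z hz
      by_cases hzX : z ∈ X
      · exact Or.inl hzX
      · exact Or.inr (mem_iUnion.2 ⟨⟨z, hzX, hz⟩, subset_closure (mem_connectedComponentIn hzX)⟩)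
    · refine union_subset (fun z hz hzC => connectedComponentIn_subset _ _ hzC hz) ?_
      refine iUnion_subset fun ⟨z, hzX, hzC⟩ => ?_
      refine closure_minimal ?_ (hopen y).isClosed_compl
      intro w hw hwC
      apply hzC
      rw [hC, connectedComponentIn_eq hwC, ← connectedComponentIn_eq hw]
      exact mem_connectedComponentIn hzX
  have hCc : IsPreconnected Cᶜ := by
    rw [hcompl]
    refine isPreconnected_union_iUnion hXc
      (fun z => isPreconnected_connectedComponentIn.closure) fun ⟨z, hzX, hzC⟩ => ?_
    have : (frontier (connectedComponentIn Xᶜ z)).Nonempty := by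
      rw [nonempty_frontier_iff]
      refine ⟨⟨z, mem_connectedComponentIn hzX⟩, fun h => ?_⟩
      obtain ⟨x, hx⟩ := hXne
      exact connectedComponentIn_subset Xᶜ z (h ▸ mem_univ x) hx
    obtain ⟨p, hp⟩ := this
    exact ⟨p, hp.1, frontier_connectedComponentIn_compl_subset hX z hp⟩
  have := hT (closure C) Cᶜ isClosed_closure (hopen y).isClosed_compl
    isPreconnected_connectedComponentIn.closure hCc (by
      refine eq_univ_of_forall fun z => ?_
      by_cases hz : z ∈ C
      exacts [Or.inl (subset_closure hz), Or.inr hz])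
  rwa [(hopen y).frontier_eq]

/-- Walking upwards through the components of four regions arranged cyclically, with opposite
regions disjoint, produces infinitely many components. -/
theorem Unicoherent.false_of_walk [LocallyConnectedSpace T] [PreconnectedSpace T]
    (hT : Unicoherent T) (R : ℕ → Set T) (hcl : ∀ k, IsClosed (R k))
    (hfin : ∀ k, Finite (ConnectedComponents (R k)))
    (hcov : ∀ k x, x ∈ R k ∨ x ∈ R (k + 1) ∨ x ∈ R (k + 2) ∨ x ∈ R (k + 3))
    (hdisj : ∀ k, Disjoint (R k) (R (k + 2))) (hper : ∀ k, R (4 * k) = R 0)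
    (p : ℕ → T) (hp : ∀ k, p k ∈ R k)
    (hmeet : ∀ k, (connectedComponentIn (R k) (p k) ∩
      connectedComponentIn (R (k + 1)) (p (k + 1))).Nonempty) : False := by
  set X : ℕ → Set T := fun k => connectedComponentIn (R k) (p k) with hXdef
  have hXR : ∀ k, X k ⊆ R k := fun k => connectedComponentIn_subset _ _
  have hXc : ∀ k, IsPreconnected (X k) := fun k => isPreconnected_connectedComponentIn
  have hXcl : ∀ k, IsClosed (X k) := fun k => isClosed_connectedComponentIn (hcl k) _
  have hpX : ∀ k, p k ∈ X k := fun k => mem_connectedComponentIn (hp k)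
  have hX2 : ∀ k, Disjoint (X k) (X (k + 2)) := fun k => (hdisj k).mono (hXR k) (hXR _)
  let D : ℕ → Set T := fun k => connectedComponentIn (X (k + 2))ᶜ (p k)
  have hpD : ∀ k, X k ⊆ D k := fun k =>
    (hXc k).subset_connectedComponentIn (hpX k) (disjoint_left.1 (hX2 k))
  have hDX : ∀ k, Disjoint (D k) (X (k + 2)) := fun k =>
    disjoint_left.2 fun x hx => connectedComponentIn_subset (X (k + 2))ᶜ (p k) hx
  have hfr : ∀ k, frontier (D k) ⊆ R (k + 1) := by
    intro k
    have hsub : frontier (D k) ⊆ X (k + 2) :=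
      frontier_connectedComponentIn_compl_subset (hXcl _) _
    have hcon : IsPreconnected (frontier (D k)) :=
      hT.isPreconnected_frontier (hXcl _) (hXc _) ⟨_, hpX _⟩ _
    have hcov2 : frontier (D k) ⊆ R (k + 1) ∪ R (k + 3) := by
      intro x hx
      have hx2 : x ∈ X (k + 2) := hsub hx
      -- The right-hand side is closed because `R (k + 2)` has finitely many components. A frontier
      -- point of `D k` lies in `X (k + 2)` and in this set, hence in a region other than `R (k +
      -- 2)`; disjointness rules out `R (k + 4)`.
      have : D k ⊆ (R (k + 2) \ X (k + 2)) ∪ (R (k + 1) ∪ R (k + 3) ∪ R (k + 4)) := by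
        intro y hy
        have hyX : y ∉ X (k + 2) := disjoint_left.1 (hDX k) hy
        rcases hcov (k + 1) y with h | h | h | h
        · exact Or.inr (Or.inl (Or.inl h))
        · exact Or.inl ⟨h, hyX⟩
        · exact Or.inr (Or.inl (Or.inr h))
        · exact Or.inr (Or.inr h)
      have hcl' : IsClosed ((R (k + 2) \ X (k + 2)) ∪ (R (k + 1) ∪ R (k + 3) ∪ R (k + 4))) := by
        have := hfin (k + 2)
        exact (isClosed_diff_connectedComponentIn (hcl _) _).union
          (((hcl _).union (hcl _)).union (hcl _))
      rcases closure_minimal this hcl' hx.1 with h | h | h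
      · exact absurd hx2 h.2
      · exact h
      · exact absurd h (disjoint_left.1 (hdisj (k + 2)) (hXR _ hx2))
    -- `X (k + 1)` leads from `X k`, inside `D k`, to `X (k + 2)`, outside it.
    obtain ⟨y, hyX, hyf⟩ : (X (k + 1) ∩ frontier (D k)).Nonempty := by
      apply inter_frontier_nonempty (hXc _)
      · exact (hmeet k).mono fun z hz => ⟨hz.2, hpD k hz.1⟩
      · exact (hmeet (k + 1)).mono fun z hz => ⟨hz.1, disjoint_right.1 (hDX k) hz.2⟩
    intro x hx
    rcases hcov2 hx with h | h
    · exact h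
    · obtain ⟨z, -, hz, hz'⟩ := isPreconnected_closed_iff.1 hcon _ _ (hcl (k + 1)) (hcl (k + 3))
        hcov2 ⟨y, hyf, hXR _ hyX⟩ ⟨x, hx, h⟩
      exact absurd hz' (disjoint_left.1 (hdisj (k + 1)) hz)
  -- `X (k + 3)` has a point in `X (k + 2)`, outside `D k`. To enter `D k` it would have to cross a
  -- frontier contained in `R (k + 1)`, which is disjoint from `R (k + 3)`.
  have hD3 : ∀ k, Disjoint (D k) (X (k + 3)) := by
    intro k
    rw [disjoint_left]
    intro x hxD hxX
    obtain ⟨w, hw, hw'⟩ := hmeet (k + 2)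
    obtain ⟨y, hyX, hyf⟩ := inter_frontier_nonempty (hXc (k + 3)) ⟨x, hxX, hxD⟩
      ⟨w, hw', disjoint_right.1 (hDX k) hw⟩
    exact disjoint_left.1 (hdisj (k + 1)) (hfr k hyf) (hXR _ hyX)
  have hDD : ∀ k, D k ⊆ D (k + 1) := by
    intro k
    have hu : IsPreconnected (D k ∪ X (k + 1)) :=
      isPreconnected_connectedComponentIn.union'
        ((hmeet k).mono fun z hz => ⟨hpD k hz.1, hz.2⟩) (hXc _)
    have : D k ∪ X (k + 1) ⊆ D (k + 1) := by
      apply hu.subset_connectedComponentIn (Or.inr (hpX _))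
      exact union_subset (disjoint_left.1 (hD3 k)) (disjoint_left.1 (hX2 (k + 1)))
    exact subset_union_left.trans this
  have hmono : Monotone D := monotone_nat_of_le_succ hDD
  have hXX : ∀ j k, j + 2 ≤ k → Disjoint (X j) (X k) := by
    intro j k hjk
    obtain ⟨m, rfl⟩ : ∃ m, k = m + 2 := ⟨k - 2, by omega⟩
    exact (hDX m).mono_left ((hpD j).trans (hmono (by omega)))
  have hfin0 := hfin 0
  -- Indices `4 * j < 4 * k` differ by at least two, so `X (4 * j)` and `X (4 * k)` are disjoint
  -- components of the same set `R 0`.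
  let f : ℕ → ConnectedComponents (R 0) := fun k =>
    ConnectedComponents.mk ⟨p (4 * k), hper k ▸ hp (4 * k)⟩
  refine not_injective_infinite_finite f fun j k hjk => ?_
  have key : ∀ j k, j < k → f j ≠ f k := by
    intro j k hlt he
    have h1 := ConnectedComponents.coe_eq_coe'.1 he
    have h2 : p (4 * j) ∈ X (4 * k) := by
      simp only [hXdef, hper]
      rw [connectedComponentIn_eq_image (hper k ▸ hp (4 * k))]
      exact ⟨_, h1, rfl⟩
    exact disjoint_left.1 (hXX (4 * j) (4 * k) (by omega)) (hpX _) h2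
  rcases lt_trichotomy j k with h | h | h
  · exact absurd hjk (key _ _ h)
  · exact h
  · exact absurd hjk.symm (key _ _ h)

end Connectedness

/-! ### Meaning of the formula, and the infinite component count -/

section Semantics

variable {T : Type*} [TopologicalSpace T]

theorem RC.sup_carrier (a b : RC T) : (a ⊔ b).carrier = a.carrier ∪ b.carrier := rfl

/-- Two regions are connected, but their sum is not. -/
def RC.NotConn (a b : RC T) : Prop :=
  IsPreconnected a.carrier ∧ IsPreconnected b.carrier ∧ ¬ IsPreconnected (a ⊔ b).carrier

theorem RC.NotConn.disjoint {a b : RC T} (h : a.NotConn b) : Disjoint a.carrier b.carrier := by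
  rw [disjoint_iff_inter_eq_empty, ← not_nonempty_iff_eq_empty]
  exact fun hne => h.2.2 (h.1.union' hne h.2.1)

theorem RC.NotConn.of_disjoint {a b : RC T} (ha : IsPreconnected a.carrier)
    (hb : IsPreconnected b.carrier) (ha' : a.carrier.Nonempty) (hb' : b.carrier.Nonempty)
    (h : Disjoint a.carrier b.carrier) : a.NotConn b :=
  ⟨ha, hb, not_isPreconnected_union_of_disjoint a.isClosed b.isClosed ha' hb' h⟩

theorem RC.ne_bot_iff {a : RC T} : a ≠ ⊥ ↔ a.carrier.Nonempty := by
  rw [nonempty_iff_ne_empty, ne_eq, ne_eq, RC.ext_iff]; rfl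

theorem conj4_holds {I : ℕ → RC T} {φ : Fin 4 → Formula} :
    (conj4 φ).Holds I ↔ ∀ i, (φ i).Holds I := by
  simp only [conj4, conj, Formula.Holds, Fin.forall_fin_succ]
  simp

theorem notC_holds {I : ℕ → RC T} {τ₁ τ₂ : Term} :
    (notC τ₁ τ₂).Holds I ↔ (τ₁.eval I).NotConn (τ₂.eval I) := Iff.rfl

theorem phiInfty_holds_iff (I : ℕ → RC T) : phiInfty.Holds I ↔
    (((r 0).eval I ⊔ (r 1).eval I ⊔ (r 2).eval I ⊔ (r 3).eval I = ⊤ ∧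
      (r 0).eval I ⊓ (r 1).eval I = ⊥ ∧ (r 0).eval I ⊓ (r 2).eval I = ⊥ ∧
      (r 0).eval I ⊓ (r 3).eval I = ⊥ ∧ (r 1).eval I ⊓ (r 2).eval I = ⊥ ∧
      (r 1).eval I ⊓ (r 3).eval I = ⊥ ∧ (r 2).eval I ⊓ (r 3).eval I = ⊥ ∧
      ∀ i, (r i).eval I ≠ ⊥) ∧
    (separationPart 0).Holds I ∧ (separationPart 1).Holds I ∧
    (∀ i, (r' i).eval I ≠ ⊥ ∧ (r' i).eval I ⊓ (r i).eval I = (r' i).eval I) ∧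
    I 8 ≠ ⊥ ∧
    (∀ i, IsPreconnected ((r' i).eval I ⊔ (r (i + 1)).eval I ⊔ I 8).carrier) ∧
    RC.NotConn ((r' 0).eval I ⊔ (r' 1).eval I ⊔ (r' 2).eval I ⊔ (r' 3).eval I) (I 8) ∧
    ∀ i, RC.NotConn ((r' i).eval I ⊔ I 9) ((d (i + 1)).eval I ⊔ I 8)) := by
  simp only [phiInfty, conj, Formula.Holds, partitionPart, conj4_holds, notC_holds]
  rfl

theorem separationPart_holds_iff (I : ℕ → RC T) (i : Fin 4) : (separationPart i).Holds I ↔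
    ((r' i).eval I ⊔ (sv i).eval I).NotConn ((r' (i + 2)).eval I ⊔ (sv (i + 2)).eval I) ∧
    ((d i).eval I ⊔ (tv i).eval I).NotConn ((d (i + 2)).eval I ⊔ (tv (i + 2)).eval I) ∧
    ((d i).eval I ⊔ I 8).NotConn ((r' (i + 2)).eval I ⊔ I 9) ∧
    ((r' i).eval I ⊔ I 9).NotConn ((d (i + 2)).eval I ⊔ I 8) := by
  simp only [separationPart, conj, Formula.Holds, notC_holds]
  rfl

theorem RC.disjoint_sup_sup {a b c e : RC T} (h : Disjoint (a ⊔ b).carrier (c ⊔ e).carrier) :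
    Disjoint a.carrier c.carrier :=
  h.mono subset_union_left subset_union_left

set_option maxRecDepth 20000 in
theorem mem_vars_phiInfty {v : ℕ} (h : v < 8) : v ∈ phiInfty.vars := by
  interval_cases v <;> decide

/-- Only the finiteness of the component sets of `rᵢ` and `r'ᵢ`, the variables below 8, has to be
contradicted. The contact constraints then generate a walk of the kind that
`Unicoherent.false_of_walk` forbids. -/
theorem exists_infinite_of_holds [LocallyConnectedSpace T] (hT : Unicoherent T) (I : ℕ → RC T)
    (h : phiInfty.Holds I) :
    ∃ v ∈ phiInfty.vars, Infinite (ConnectedComponents (I v).carrier) := by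
  by_contra! hno
  have hfin : ∀ v < 8, Finite (ConnectedComponents (I v).carrier) := fun v hv =>
    hno v (mem_vars_phiInfty hv)
  obtain ⟨⟨hcov, -⟩, hs0, hs1, hr', ht, hconn, htr, hstep⟩ := (phiInfty_holds_iff I).1 h
  rw [separationPart_holds_iff] at hs0 hs1
  set ρ : Fin 4 → RC T := fun i => (r i).eval I with hρ
  set ρ' : Fin 4 → RC T := fun i => (r' i).eval I with hρ'
  set δ : Fin 4 → RC T := fun i => (d i).eval I with hδ
  have hsplit : ∀ i, ρ i = ρ' i ⊔ δ i := by
    intro i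
    change ρ i = ρ' i ⊔ (ρ i ⊓ (ρ' i)ᶜ)
    have := (hr' i).2
    rw [← _root_.sdiff_eq, sup_sdiff_cancel_right (inf_eq_left.1 this)]
  have hrr : ∀ i, Disjoint (ρ' i).carrier (ρ' (i + 2)).carrier := by
    intro i
    fin_cases i
    exacts [RC.disjoint_sup_sup hs0.1.disjoint, RC.disjoint_sup_sup hs1.1.disjoint,
      (RC.disjoint_sup_sup hs0.1.disjoint).symm, (RC.disjoint_sup_sup hs1.1.disjoint).symm]
  have hdd : ∀ i, Disjoint (δ i).carrier (δ (i + 2)).carrier := by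
    intro i
    fin_cases i
    exacts [RC.disjoint_sup_sup hs0.2.1.disjoint, RC.disjoint_sup_sup hs1.2.1.disjoint,
      (RC.disjoint_sup_sup hs0.2.1.disjoint).symm, (RC.disjoint_sup_sup hs1.2.1.disjoint).symm]
  have hrd : ∀ i, Disjoint (ρ' i).carrier (δ (i + 2)).carrier := by
    intro i
    fin_cases i
    exacts [RC.disjoint_sup_sup hs0.2.2.2.disjoint, RC.disjoint_sup_sup hs1.2.2.2.disjoint,
      (RC.disjoint_sup_sup hs0.2.2.1.disjoint).symm, (RC.disjoint_sup_sup hs1.2.2.1.disjoint).symm]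
  have hdisj : ∀ i, Disjoint (ρ i).carrier (ρ (i + 2)).carrier := by
    intro i
    rw [hsplit i, hsplit (i + 2), RC.sup_carrier, RC.sup_carrier, disjoint_union_left,
      disjoint_union_right, disjoint_union_right]
    refine ⟨⟨hrr i, hrd i⟩, ?_, hdd i⟩
    have := hrd (i + 2)
    rw [show i + 2 + 2 = i by fin_cases i <;> rfl] at this
    exact this.symm
  have hr'd : ∀ i, Disjoint (ρ' i).carrier (δ (i + 1)).carrier := fun i =>
    RC.disjoint_sup_sup (hstep i).disjoint
  have hr't : ∀ i, Disjoint (ρ' i).carrier (I 8).carrier := by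
    intro i
    refine htr.disjoint.mono_left ?_
    intro x hx
    fin_cases i
    exacts [Or.inl (Or.inl (Or.inl hx)), Or.inl (Or.inl (Or.inr hx)), Or.inl (Or.inr hx), Or.inr hx]
  have hcovx : ∀ i x, x ∈ (ρ i).carrier ∨ x ∈ (ρ (i + 1)).carrier ∨ x ∈ (ρ (i + 2)).carrier ∨
      x ∈ (ρ (i + 3)).carrier := by
    intro i x
    have : x ∈ (ρ 0 ⊔ ρ 1 ⊔ ρ 2 ⊔ ρ 3).carrier := by
      change x ∈ ((r 0).eval I ⊔ (r 1).eval I ⊔ (r 2).eval I ⊔ (r 3).eval I).carrier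
      rw [hcov]; exact mem_univ x
    have : x ∈ (ρ 0).carrier ∨ x ∈ (ρ 1).carrier ∨ x ∈ (ρ 2).carrier ∨ x ∈ (ρ 3).carrier := by
      rcases this with ((h | h) | h) | h <;> tauto
    fin_cases i <;> simp only [Fin.reduceFinMk, Fin.isValue, Fin.reduceAdd, zero_add] <;> tauto
  obtain ⟨x₀, hx₀⟩ := RC.ne_bot_iff.1 ht
  -- Connectedness of the space comes from the formula: the connected sets `r'ᵢ + rᵢ₊₁ + t` cover it
  -- and share the points of `t`.
  have : PreconnectedSpace T := by
    refine ⟨?_⟩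
    have e : (univ : Set T) = ⋃₀ range fun i => (ρ' i ⊔ ρ (i + 1) ⊔ I 8).carrier := by
      refine (eq_univ_of_forall fun x => ?_).symm
      have key : ∀ i, x ∈ (ρ (i + 1)).carrier →
          x ∈ ⋃₀ range fun i => (ρ' i ⊔ ρ (i + 1) ⊔ I 8).carrier := fun i hi =>
        ⟨_, ⟨i, rfl⟩, Or.inl (Or.inr hi)⟩
      rcases hcovx 1 x with h | h | h | h
      exacts [key 0 h, key 1 h, key 2 h, key 3 h]
    rw [e]
    refine isPreconnected_sUnion x₀ _ ?_ ?_
    · rintro _ ⟨i, rfl⟩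
      exact Or.inr hx₀
    · rintro _ ⟨i, rfl⟩
      exact hconn i
  have hfinρ : ∀ i, Finite (ConnectedComponents (ρ i).carrier) := fun i => hfin i.val (by omega)
  have hfinρ' : ∀ i, Finite (ConnectedComponents (ρ' i).carrier) := fun i =>
    hfin (4 + i.val) (by omega)
  -- Otherwise the component `C` of `x` in `ρ' i` would miss `ρ (i + 1)`. It misses `t` and the rest
  -- of `ρ' i` as well, and that rest is closed by finiteness, so `C` would split off from the
  -- connected set `r'ᵢ + rᵢ₊₁ + t`.
  have hnext : ∀ i, ∀ x ∈ (ρ' i).carrier, ∃ y ∈ (ρ' (i + 1)).carrier,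
      y ∈ connectedComponentIn (ρ i).carrier x := by
    intro i x hx
    have := hfinρ' i
    by_contra! hno
    set C := connectedComponentIn (ρ' i).carrier x with hC
    have hCcl : IsClosed C := isClosed_connectedComponentIn (ρ' i).isClosed x
    have hCsub : C ⊆ (ρ' i).carrier := connectedComponentIn_subset _ _
    have hCρ : C ⊆ connectedComponentIn (ρ i).carrier x :=
      connectedComponentIn_mono x (by rw [hsplit i]; exact subset_union_left)
    have hCd : ∀ z ∈ C, z ∉ (ρ (i + 1)).carrier := by
      intro z hz hz'
      rw [hsplit] at hz'
      rcases hz' with h | h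
      · exact hno z h (hCρ hz)
      · exact disjoint_left.1 (hr'd i) (hCsub hz) h
    refine not_isPreconnected_union_of_disjoint hCcl
      (B := ((ρ' i).carrier \ C) ∪ (ρ (i + 1)).carrier ∪ (I 8).carrier)
      (((isClosed_diff_connectedComponentIn (ρ' i).isClosed x).union (ρ (i + 1)).isClosed).union
        (I 8).isClosed) ⟨x, mem_connectedComponentIn hx⟩ ⟨x₀, Or.inr hx₀⟩ ?_ ?_
    · rw [disjoint_left]
      rintro z hz ((h | h) | h)
      exacts [h.2 hz, hCd z hz h, disjoint_left.1 (hr't i) (hCsub hz) h]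
    · have e := hconn i
      change IsPreconnected ((ρ' i).carrier ∪ (ρ (i + 1)).carrier ∪ (I 8).carrier) at e
      rwa [← union_assoc, ← union_assoc, union_sdiff_cancel hCsub]
  let c : ℕ → Fin 4 := fun k => ⟨k % 4, Nat.mod_lt _ (by norm_num)⟩
  have hc : ∀ k j, c (k + j) = c k + c j := fun k j => by
    ext; simp [c, Fin.val_add]
  obtain ⟨p₀, hp₀⟩ := RC.ne_bot_iff.1 (hr' 0).1
  choose! g hg hg' using hnext
  let p : ℕ → T := fun k => Nat.rec p₀ (fun k x => g (c k) x) k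
  have hp : ∀ k, p k ∈ (ρ' (c k)).carrier := by
    intro k
    induction k with
    | zero => exact hp₀
    | succ k ih => rw [hc k 1]; exact hg (c k) _ ih
  have hpρ : ∀ k, p k ∈ (ρ (c k)).carrier := fun k => by
    rw [hsplit]; exact Or.inl (hp k)
  refine hT.false_of_walk (fun k => (ρ (c k)).carrier) (fun k => (ρ (c k)).isClosed)
    (fun k => hfinρ _) ?_ ?_ ?_ p hpρ ?_
  · intro k x
    simp only [hc]
    exact hcovx (c k) x
  · intro k
    simp only [hc]
    exact hdisj (c k)
  · intro k
    have : c (4 * k) = c 0 := by ext; simp [c]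
    simp only [this]
  · intro k
    exact ⟨p (k + 1), hg' (c k) _ (hp k), mem_connectedComponentIn (hpρ (k + 1))⟩

end Semantics

/-! ### Unicoherence of simply connected spaces -/

section Unicoherence

variable {T : Type*} [TopologicalSpace T]

/-- Simply connected, locally path connected normal spaces are unicoherent: a separation of the
intersection yields a map to the circle without a continuous logarithm. -/
theorem unicoherent_of_simplyConnected [NormalSpace T] [SimplyConnectedSpace T]
    [LocallyPathConnectedSpace T] : Unicoherent T := by
  intro X Y hX hY hXc hYc hXY
  rw [isPreconnected_iff_subset_of_fully_disjoint_closed (hX.inter hY)]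
  intro u v hu hv huv hdis
  by_contra! hno
  obtain ⟨⟨b, hb, hbu⟩, ⟨a, ha, hav⟩⟩ := And.imp not_subset.1 not_subset.1 hno
  have hau := (huv ha).resolve_right hav
  have hbv := (huv hb).resolve_left hbu
  obtain ⟨f, hf0, hf1, -⟩ := exists_continuous_zero_one_of_isClosed hu hv hdis
  classical
  -- The two formulas agree on `X ∩ Y`: both give 1 on `u` and -1 on `v`.
  let g : T → Circle := fun x =>
    if x ∈ X then Circle.exp (Real.pi * f x) else Circle.exp (-(Real.pi * f x))
  have hgX : EqOn g (fun x => Circle.exp (Real.pi * f x)) X := fun x hx => if_pos hx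
  have hgY : EqOn g (fun x => Circle.exp (-(Real.pi * f x))) Y := by
    intro x hx
    by_cases hxX : x ∈ X
    · rw [hgX hxX]
      rcases huv ⟨hxX, hx⟩ with h | h
      · simp [hf0 h]
      · beta_reduce
        rw [hf1 h]
        ext
        simp [Circle.coe_exp]
    · exact if_neg hxX
  have hg : Continuous g := by
    rw [← continuousOn_univ, ← hXY]
    refine ContinuousOn.union_of_isClosed ?_ ?_ hX hY
    · exact ContinuousOn.congr (by fun_prop) hgX
    · exact ContinuousOn.congr (by fun_prop) hgY
  have hga : g a = 1 := by rw [hgX ha.1]; simp [hf0 hau]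
  obtain ⟨F, ⟨hFa, hF⟩, -⟩ := Circle.isCoveringMap_exp.existsUnique_continuousMap_lifts
    ⟨g, hg⟩ a 0 (by simp [hga])
  have hF' : ∀ x, Circle.exp (F x) = g x := fun x => congr_fun hF x
  -- Uniqueness of lifts on the connected sets `X` and `Y`, starting from `a`, makes `F` equal to `π
  -- f` on one and `-π f` on the other; at `b`, where `f = 1`, this gives `π = -π`.
  have h1 : EqOn F (fun x => Real.pi * f x) X :=
    Circle.isCoveringMap_exp.eqOn_of_comp_eqOn hXc F.continuous.continuousOn
      (by fun_prop) (fun x hx => (hF' x).trans (hgX hx)) ha.1 (by simp [hFa, hf0 hau])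
  have h2 : EqOn F (fun x => -(Real.pi * f x)) Y :=
    Circle.isCoveringMap_exp.eqOn_of_comp_eqOn hYc F.continuous.continuousOn
      (by fun_prop) (fun x hx => (hF' x).trans (hgY hx)) ha.2 (by simp [hFa, hf0 hau])
  have h3 := (h1 hb.1).symm.trans (h2 hb.2)
  simp only [hf1 hbv, Pi.one_apply, mul_one] at h3
  linarith [Real.pi_pos]

end Unicoherence

/-! ### Polyhedra have finitely many components -/

section Polyhedra

/-- Sending a component to the index of a piece containing a chosen point of it is injective,
because each piece lies in a single component. -/
theorem finite_connectedComponents_of_biUnion {T : Type*} [TopologicalSpace T] {ι : Type*}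
    {s : Finset ι} {C : ι → Set T} {A : Set T} (hA : A = ⋃ i ∈ s, C i)
    (hC : ∀ i ∈ s, IsPreconnected (C i)) : Finite (ConnectedComponents A) := by
  have hex : ∀ x : A, ∃ i : s, (x : T) ∈ C i := by
    rintro ⟨x, hx⟩
    rw [hA] at hx
    obtain ⟨i, hi, hxi⟩ := mem_iUnion₂.1 hx
    exact ⟨⟨i, hi⟩, hxi⟩
  choose f hf using hex
  refine Finite.of_injective
    (fun c : ConnectedComponents A => f (ConnectedComponents.surjective_coe c).choose) ?_
  intro c e hce
  have hc := (ConnectedComponents.surjective_coe c).choose_spec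
  have he := (ConnectedComponents.surjective_coe e).choose_spec
  rw [← hc, ← he, ConnectedComponents.coe_eq_coe']
  set x := (ConnectedComponents.surjective_coe c).choose
  set y := (ConnectedComponents.surjective_coe e).choose
  have hsub : C (f y) ⊆ A := by
    rw [hA]; exact subset_biUnion_of_mem (u := C) (f y).2
  have hpre : IsPreconnected ((↑) ⁻¹' C (f y) : Set A) := by
    rw [← IsInducing.subtypeVal.isPreconnected_image, Subtype.image_preimage_coe,
      inter_eq_right.2 hsub]
    exact hC _ (f y).2
  have hx : x ∈ ((↑) ⁻¹' C (f y) : Set A) := by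
    have : f x = f y := hce
    rw [← this]
    exact hf x
  exact hpre.subset_connectedComponent (hf y) hx

variable {E : Type*} [NormedAddCommGroup E] [NormedSpace ℝ E]

/-- Finite sums of convex regions. -/
def RC.IsConvexSum (a : RC E) : Prop :=
  ∃ s : Finset (RC E), (∀ b ∈ s, Convex ℝ b.carrier) ∧ s.sup id = a

theorem RC.IsConvexSum.of_convex {a : RC E} (h : Convex ℝ a.carrier) : a.IsConvexSum :=
  ⟨{a}, by simpa using h, by simp⟩

theorem RC.IsConvexSum.sup {a b : RC E} (ha : a.IsConvexSum) (hb : b.IsConvexSum) :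
    (a ⊔ b).IsConvexSum := by
  classical
  obtain ⟨s, hs, rfl⟩ := ha
  obtain ⟨u, hu, rfl⟩ := hb
  refine ⟨s ∪ u, fun c hc => ?_, Finset.sup_union⟩
  rcases Finset.mem_union.1 hc with h | h
  exacts [hs c h, hu c h]

theorem RC.IsConvexSum.inf {a b : RC E} (ha : a.IsConvexSum) (hb : b.IsConvexSum) :
    (a ⊓ b).IsConvexSum := by
  classical
  obtain ⟨s, hs, rfl⟩ := ha
  obtain ⟨u, hu, rfl⟩ := hb
  refine ⟨(s ×ˢ u).image fun p => p.1 ⊓ p.2, fun c hc => ?_, ?_⟩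
  · obtain ⟨⟨p, q⟩, hp, rfl⟩ := Finset.mem_image.1 hc
    rw [Finset.mem_product] at hp
    exact (((hs p hp.1).inter (hu q hp.2)).interior).closure
  · rw [Finset.sup_image, Finset.sup_inf_sup]
    rfl

theorem RC.sup_carrier_finset {T : Type*} [TopologicalSpace T] (s : Finset (RC T)) :
    (s.sup id).carrier = ⋃ a ∈ s, a.carrier := by
  classical
  induction s using Finset.induction_on with
  | empty => simp; rfl
  | insert a s _ ih => simp [RC.sup_carrier, ih]

theorem RC.IsConvexSum.finite_connectedComponents {a : RC E} (h : a.IsConvexSum) :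
    Finite (ConnectedComponents a.carrier) := by
  obtain ⟨s, hs, rfl⟩ := h
  exact finite_connectedComponents_of_biUnion (RC.sup_carrier_finset s)
    fun b hb => (hs b hb).isPreconnected

/-- Carrying the complement through the induction makes the complement step trivial; the sum step
then needs only closure of convex sums under `⊔` and `⊓`. -/
theorem isConvexSum_of_mem_RCP {n : ℕ} {a : RC (EuclideanSpace ℝ (Fin n))} (h : a ∈ RCP n) :
    a.IsConvexSum ∧ aᶜ.IsConvexSum := by
  induction h using BooleanSubalgebra.closure_bot_sup_induction with
  | mem a ha =>
    obtain ⟨v, c, -, hc⟩ := ha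
    constructor
    · apply RC.IsConvexSum.of_convex
      rw [hc]
      exact convex_halfSpace_le (innerₗ _ v).isLinear c
    · apply RC.IsConvexSum.of_convex
      change Convex ℝ (closure a.carrierᶜ)
      rw [hc, compl_ofPred]
      simp only [not_le]
      exact (convex_halfSpace_gt (innerₗ _ v).isLinear c).closure
  | bot => exact ⟨.of_convex convex_empty, by rw [compl_bot]; exact .of_convex convex_univ⟩
  | sup a _ b _ ha hb => exact ⟨ha.1.sup hb.1, by rw [compl_sup]; exact ha.2.inf hb.2⟩
  | compl a _ ha => exact ⟨ha.2, by rw [compl_compl]; exact ha.1⟩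

theorem phiInfty_notMem_sat_RCP (n : ℕ) : phiInfty ∉ Sat (RCP n) := by
  rintro ⟨I, hI, h⟩
  obtain ⟨v, -, hv⟩ := exists_infinite_of_holds unicoherent_of_simplyConnected I h
  have := (isConvexSum_of_mem_RCP (hI v)).1.finite_connectedComponents
  exact not_finite (ConnectedComponents (I v).carrier)

end Polyhedra

/-! ### Transfer of satisfaction from the plane to `ℝⁿ` -/

section Comap

variable {S T : Type*} [TopologicalSpace S] [TopologicalSpace T] {f : S → T}

/-- The preimage of a region under a continuous open map. -/
def RC.comap (f : S → T) (ho : IsOpenMap f) (hc : Continuous f) (a : RC T) : RC S where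
  carrier := f ⁻¹' a.carrier
  closure_interior' := by
    rw [← ho.preimage_interior_eq_interior_preimage hc,
      ← ho.preimage_closure_eq_closure_preimage hc, a.closure_interior']

/-- Preimages under a continuous open map commute with interior and closure, hence with all
operations of the algebra. -/
theorem Term.eval_comap (ho : IsOpenMap f) (hc : Continuous f) (I : ℕ → RC T) (τ : Term) :
    τ.eval (fun v => (I v).comap f ho hc) = (τ.eval I).comap f ho hc := by
  induction τ with
  | var v => rfl
  | add τ₁ τ₂ h₁ h₂ => simp only [Term.eval, h₁, h₂]; rfl
  | mul τ₁ τ₂ h₁ h₂ =>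
    simp only [Term.eval, h₁, h₂]
    refine RC.ext ?_
    change closure (interior (f ⁻¹' _ ∩ f ⁻¹' _)) = f ⁻¹' (closure (interior (_ ∩ _)))
    rw [ho.preimage_closure_eq_closure_preimage hc, ho.preimage_interior_eq_interior_preimage hc,
      preimage_inter]
  | neg τ h =>
    simp only [Term.eval, h]
    refine RC.ext ?_
    change closure (f ⁻¹' _)ᶜ = f ⁻¹' (closure _)
    rw [ho.preimage_closure_eq_closure_preimage hc, preimage_compl]
  | zero => rfl
  | one => rfl

theorem Formula.holds_comap (ho : IsOpenMap f) (hc : Continuous f) (hs : Function.Surjective f)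
    (hp : ∀ A : Set T, IsPreconnected A → IsPreconnected (f ⁻¹' A)) (I : ℕ → RC T) (φ : Formula) :
    φ.Holds (fun v => (I v).comap f ho hc) ↔ φ.Holds I := by
  induction φ with
  | eq τ₁ τ₂ =>
    simp only [Formula.Holds, Term.eval_comap]
    constructor
    · intro h
      exact RC.ext (hs.preimage_injective (congrArg RC.carrier h))
    · intro h
      rw [h]
  | conn τ =>
    simp only [Formula.Holds, Term.eval_comap]
    constructor
    · intro h
      have := h.image f hc.continuousOn
      change IsPreconnected (f '' (f ⁻¹' _)) at this
      rwa [image_preimage_eq _ hs] at this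
    · exact hp _
  | or φ₁ φ₂ h₁ h₂ => simp only [Formula.Holds, h₁, h₂]
  | and φ₁ φ₂ h₁ h₂ => simp only [Formula.Holds, h₁, h₂]
  | not φ h => simp only [Formula.Holds, h]

/-- Preimages of preconnected sets under a map with preconnected fibres and a continuous section
are preconnected. -/
theorem isPreconnected_preimage_of_section {g : T → S} (hg : Continuous g)
    (hgf : Function.LeftInverse f g) (hfib : ∀ x, IsPreconnected (f ⁻¹' {x})) {A : Set T}
    (hA : IsPreconnected A) : IsPreconnected (f ⁻¹' A) := by
  -- The section embeds `A` as a connected spine, to which each connected fibre is attached.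
  have e : f ⁻¹' A = g '' A ∪ ⋃ x : A, f ⁻¹' {(x : T)} := by
    ext y
    simp only [mem_preimage, mem_union, mem_iUnion, mem_singleton_iff, mem_image]
    constructor
    · intro hy
      exact Or.inr ⟨⟨f y, hy⟩, rfl⟩
    · rintro (⟨x, hx, rfl⟩ | ⟨x, hx⟩)
      exacts [(hgf x).symm ▸ hx, hx ▸ x.2]
  rw [e]
  exact isPreconnected_union_iUnion (hA.image g hg.continuousOn) (fun x => hfib x)
    fun x => ⟨g x, hgf x, x, x.2, rfl⟩

end Comap

/-- Satisfiability in the plane transfers to `ℝⁿ` along the first two coordinates. -/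
theorem phiInfty_mem_sat_of_plane {I : ℕ → RC (ℝ × ℝ)} (hI : phiInfty.Holds I) {n : ℕ}
    (hn : 2 ≤ n) : phiInfty ∈ Sat (⊤ : BooleanSubalgebra (RC (EuclideanSpace ℝ (Fin n)))) := by
  let i₀ : Fin n := ⟨0, by omega⟩
  let i₁ : Fin n := ⟨1, by omega⟩
  have h01 : i₀ ≠ i₁ := by simp [i₀, i₁]
  let f : EuclideanSpace ℝ (Fin n) →L[ℝ] ℝ × ℝ :=
    (EuclideanSpace.proj i₀).prod (EuclideanSpace.proj i₁)
  let g : ℝ × ℝ → EuclideanSpace ℝ (Fin n) := fun p =>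
    p.1 • EuclideanSpace.single i₀ (1 : ℝ) + p.2 • EuclideanSpace.single i₁ (1 : ℝ)
  have hg : Continuous g := by fun_prop
  have hgf : Function.LeftInverse f g := by
    intro p
    ext <;> simp [f, g, h01, h01.symm]
  have hs : Function.Surjective f := hgf.surjective
  have ho : IsOpenMap f := f.isOpenMap hs
  have hfib : ∀ x, IsPreconnected (f ⁻¹' {x}) := fun x =>
    ((convex_singleton x).is_linear_preimage f.toLinearMap.isLinear).isPreconnected
  refine ⟨fun v => (I v).comap f ho f.continuous, fun v => trivial, ?_⟩
  rw [Formula.holds_comap ho f.continuous hs]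
  · exact hI
  · exact fun A => isPreconnected_preimage_of_section hg hgf hfib

/-! ### A model in the plane built from square shells -/

noncomputable section Plane

/-- The product of two regions. -/
def RC.prod {S T : Type*} [TopologicalSpace S] [TopologicalSpace T] (a : RC S) (b : RC T) :
    RC (S × T) where
  carrier := a.carrier ×ˢ b.carrier
  closure_interior' := by
    rw [interior_prod_eq, closure_prod_eq, a.closure_interior', b.closure_interior']

/-- A nondegenerate closed interval. -/
def RC.Icc {a b : ℝ} (h : a < b) : RC ℝ where
  carrier := Set.Icc a b
  closure_interior' := by rw [interior_Icc, closure_Ioo h.ne]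

def RC.Ici (a : ℝ) : RC ℝ where
  carrier := Set.Ici a
  closure_interior' := by rw [interior_Ici, closure_Ioi]

def RC.Iic (a : ℝ) : RC ℝ where
  carrier := Set.Iic a
  closure_interior' := by rw [interior_Iic, closure_Iio]

/-- The union of every fourth member, from the `i`-th on, of a sequence of plane regions that
tends to infinity. -/
def RC.everyFourth (a : ℕ → RC (ℝ × ℝ)) (h : ∀ k, ∀ p ∈ (a k).carrier, (k : ℝ) ≤ ‖p‖) (i : ℕ) :
    RC (ℝ × ℝ) where
  carrier := ⋃ m, (a (4 * m + i)).carrier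
  closure_interior' := by
    -- Near `p` only regions with index below `‖p‖ + 1` occur; local finiteness makes the union
    -- closed.
    have hlf : LocallyFinite fun k => (a k).carrier := by
      intro p
      refine ⟨{q | ‖q‖ < ‖p‖ + 1}, (isOpen_lt continuous_norm continuous_const).mem_nhds
        (by simp), (finite_Iio (⌈‖p‖ + 1⌉₊)).subset ?_⟩
      rintro k ⟨q, hq, hq'⟩
      exact Nat.lt_ceil.2 ((h k q hq).trans_lt hq')
    have hcl : IsClosed (⋃ m, (a (4 * m + i)).carrier) :=
      (hlf.comp_injective (g := fun m => 4 * m + i) fun m n (hmn : 4 * m + i = 4 * n + i) => by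
        omega).isClosed_iUnion fun m => (a _).isClosed
    apply Subset.antisymm
    · exact closure_minimal interior_subset hcl
    · refine iUnion_subset fun m => ?_
      conv_lhs => rw [← (a (4 * m + i)).closure_interior']
      exact closure_mono (interior_mono (subset_iUnion (fun m => (a (4 * m + i)).carrier) m))

theorem RC.mem_everyFourth {a : ℕ → RC (ℝ × ℝ)} {h} {i : ℕ} {p : ℝ × ℝ} :
    p ∈ (RC.everyFourth a h i).carrier ↔ ∃ m, p ∈ (a (4 * m + i)).carrier := mem_iUnion

/-- Plane regions that share only points with an integer coordinate have zero product. -/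
theorem RC.inf_eq_bot_of_generic {a b : RC (ℝ × ℝ)}
    (h : ∀ p, p ∈ a.carrier → p ∈ b.carrier → ∃ n : ℤ, p.1 = n ∨ p.2 = n) : a ⊓ b = ⊥ := by
  refine RC.ext ?_
  change closure (interior (a.carrier ∩ b.carrier)) = ∅
  rw [closure_empty_iff, ← not_nonempty_iff_eq_empty]
  intro hne
  have hd : Dense (range ((↑) : ℤ → ℝ))ᶜ := (countable_range _).dense_compl ℝ
  obtain ⟨p, hp, hp1, hp2⟩ := (hd.prod hd).inter_open_nonempty _ isOpen_interior hne
  obtain ⟨ha, hb⟩ := interior_subset hp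
  obtain ⟨n, hn | hn⟩ := h p ha hb
  exacts [hp1 ⟨n, hn.symm⟩, hp2 ⟨n, hn.symm⟩]

/-! The `k`-th square shell `k ≤ ‖p‖ ≤ k + 1` consists of its left side and of three further
sides. -/

def leftSide (k : ℕ) : RC (ℝ × ℝ) :=
  (RC.Icc (show (-(k + 1) : ℝ) < -k by linarith)).prod
    (RC.Icc (show (-(k + 1) : ℝ) < k + 1 by linarith [k.cast_nonneg (α := ℝ)]))

def topSide (k : ℕ) : RC (ℝ × ℝ) :=
  (RC.Icc (show (-k : ℝ) < k + 1 by linarith [k.cast_nonneg (α := ℝ)])).prod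
    (RC.Icc (show (k : ℝ) < k + 1 by linarith))

def rightSide (k : ℕ) : RC (ℝ × ℝ) :=
  (RC.Icc (show (k : ℝ) < k + 1 by linarith)).prod
    (RC.Icc (show (-(k + 1) : ℝ) < k + 1 by linarith [k.cast_nonneg (α := ℝ)]))

def bottomSide (k : ℕ) : RC (ℝ × ℝ) :=
  (RC.Icc (show (-k : ℝ) < k + 1 by linarith [k.cast_nonneg (α := ℝ)])).prod
    (RC.Icc (show (-(k + 1) : ℝ) < -k by linarith))

def threeSides (k : ℕ) : RC (ℝ × ℝ) := topSide k ⊔ rightSide k ⊔ bottomSide k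

/-- The part of the left side above the axis. -/
def leftUpper (k : ℕ) : RC (ℝ × ℝ) :=
  (RC.Icc (show (-(k + 1) : ℝ) < -k by linarith)).prod
    (RC.Icc (show (1 / 4 : ℝ) < k + 1 by linarith [k.cast_nonneg (α := ℝ)]))

/-- The part of the left side below the axis. -/
def leftLower (k : ℕ) : RC (ℝ × ℝ) :=
  (RC.Icc (show (-(k + 1) : ℝ) < -k by linarith)).prod
    (RC.Icc (show (-(k + 1) : ℝ) < -1 / 4 by linarith [k.cast_nonneg (α := ℝ)]))

variable {k l i j : ℕ} {p : ℝ × ℝ}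

theorem mem_leftSide : p ∈ (leftSide k).carrier ↔
    (-(k + 1) ≤ p.1 ∧ p.1 ≤ -k) ∧ -(k + 1) ≤ p.2 ∧ p.2 ≤ k + 1 := Iff.rfl

theorem mem_topSide : p ∈ (topSide k).carrier ↔
    (-k ≤ p.1 ∧ p.1 ≤ k + 1) ∧ k ≤ p.2 ∧ p.2 ≤ k + 1 := Iff.rfl

theorem mem_rightSide : p ∈ (rightSide k).carrier ↔
    (k ≤ p.1 ∧ p.1 ≤ k + 1) ∧ -(k + 1) ≤ p.2 ∧ p.2 ≤ k + 1 := Iff.rfl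

theorem mem_bottomSide : p ∈ (bottomSide k).carrier ↔
    (-k ≤ p.1 ∧ p.1 ≤ k + 1) ∧ -(k + 1) ≤ p.2 ∧ p.2 ≤ -k := Iff.rfl

theorem mem_leftUpper : p ∈ (leftUpper k).carrier ↔
    (-(k + 1) ≤ p.1 ∧ p.1 ≤ -k) ∧ 1 / 4 ≤ p.2 ∧ p.2 ≤ k + 1 := Iff.rfl

theorem mem_leftLower : p ∈ (leftLower k).carrier ↔
    (-(k + 1) ≤ p.1 ∧ p.1 ≤ -k) ∧ -(k + 1) ≤ p.2 ∧ p.2 ≤ -1 / 4 := Iff.rfl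

theorem mem_threeSides : p ∈ (threeSides k).carrier ↔
    (p ∈ (topSide k).carrier ∨ p ∈ (rightSide k).carrier) ∨ p ∈ (bottomSide k).carrier := Iff.rfl

theorem norm_mem_of_bounds {a : ℝ} (h : (a ≤ p.1 ∨ p.1 ≤ -a) ∨ (a ≤ p.2 ∨ p.2 ≤ -a))
    (h' : (-(a + 1) ≤ p.1 ∧ p.1 ≤ a + 1) ∧ -(a + 1) ≤ p.2 ∧ p.2 ≤ a + 1) :
    a ≤ ‖p‖ ∧ ‖p‖ ≤ a + 1 := by
  rw [Prod.norm_def, Real.norm_eq_abs, Real.norm_eq_abs, le_max_iff, max_le_iff, le_abs', le_abs',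
    abs_le, abs_le]
  tauto

theorem norm_of_mem_leftSide (h : p ∈ (leftSide k).carrier) : k ≤ ‖p‖ ∧ ‖p‖ ≤ k + 1 := by
  rw [mem_leftSide] at h
  have := k.cast_nonneg (α := ℝ)
  exact norm_mem_of_bounds (Or.inl (Or.inr h.1.2)) ⟨⟨h.1.1, by linarith [h.1.2]⟩, h.2⟩

theorem norm_of_mem_topSide (h : p ∈ (topSide k).carrier) : k ≤ ‖p‖ ∧ ‖p‖ ≤ k + 1 := by
  rw [mem_topSide] at h
  have := k.cast_nonneg (α := ℝ)
  exact norm_mem_of_bounds (Or.inr (Or.inl h.2.1))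
    ⟨⟨by linarith [h.1.1], h.1.2⟩, by linarith [h.2.1], h.2.2⟩

theorem norm_of_mem_rightSide (h : p ∈ (rightSide k).carrier) : k ≤ ‖p‖ ∧ ‖p‖ ≤ k + 1 := by
  rw [mem_rightSide] at h
  have := k.cast_nonneg (α := ℝ)
  exact norm_mem_of_bounds (Or.inl (Or.inl h.1.1)) ⟨⟨by linarith [h.1.1], h.1.2⟩, h.2⟩

theorem norm_of_mem_bottomSide (h : p ∈ (bottomSide k).carrier) : k ≤ ‖p‖ ∧ ‖p‖ ≤ k + 1 := by
  rw [mem_bottomSide] at h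
  have := k.cast_nonneg (α := ℝ)
  exact norm_mem_of_bounds (Or.inr (Or.inr h.2.2))
    ⟨⟨by linarith [h.1.1], h.1.2⟩, h.2.1, by linarith [h.2.2]⟩

theorem norm_of_mem_threeSides (h : p ∈ (threeSides k).carrier) : k ≤ ‖p‖ ∧ ‖p‖ ≤ k + 1 := by
  rcases h with (h | h) | h
  exacts [norm_of_mem_topSide h, norm_of_mem_rightSide h, norm_of_mem_bottomSide h]

theorem leftUpper_subset : (leftUpper k).carrier ⊆ (leftSide k).carrier := by
  intro p h
  rw [mem_leftUpper] at h
  have := k.cast_nonneg (α := ℝ)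
  exact ⟨h.1, by linarith [h.2.1], h.2.2⟩

theorem leftLower_subset : (leftLower k).carrier ⊆ (leftSide k).carrier := by
  intro p h
  rw [mem_leftLower] at h
  have := k.cast_nonneg (α := ℝ)
  exact ⟨h.1, h.2.1, by linarith [h.2.2]⟩

theorem topSide_subset : (topSide k).carrier ⊆ (threeSides k).carrier :=
  fun _ h => Or.inl (Or.inl h)

theorem bottomSide_subset : (bottomSide k).carrier ⊆ (threeSides k).carrier := fun _ h => Or.inr h

theorem mem_threeSides_iff : p ∈ (threeSides k).carrier ↔
    (-k ≤ p.1 ∧ p.1 ≤ k + 1) ∧ (-(k + 1) ≤ p.2 ∧ p.2 ≤ k + 1) ∧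
      (k ≤ p.1 ∨ k ≤ p.2 ∨ p.2 ≤ -k) := by
  have := k.cast_nonneg (α := ℝ)
  rw [mem_threeSides, mem_topSide, mem_rightSide, mem_bottomSide]
  constructor
  · rintro ((h | h) | h)
    · exact ⟨h.1, ⟨by linarith [h.2.1], h.2.2⟩, Or.inr (Or.inl h.2.1)⟩
    · exact ⟨⟨by linarith [h.1.1], h.1.2⟩, h.2, Or.inl h.1.1⟩
    · exact ⟨h.1, ⟨h.2.1, by linarith [h.2.2]⟩, Or.inr (Or.inr h.2.2)⟩
  · rintro ⟨h1, h2, h3 | h3 | h3⟩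
    · exact Or.inl (Or.inr ⟨⟨h3, h1.2⟩, h2⟩)
    · exact Or.inl (Or.inl ⟨h1, h3, h2.2⟩)
    · exact Or.inr ⟨h1, h2.1, h3⟩

/-- The shells cover the plane. -/
theorem exists_mem_shell (p : ℝ × ℝ) :
    ∃ k, p ∈ (threeSides k).carrier ∨ p ∈ (leftSide k).carrier := by
  refine ⟨⌊‖p‖⌋₊, ?_⟩
  have h1 : (⌊‖p‖⌋₊ : ℝ) ≤ ‖p‖ := Nat.floor_le (norm_nonneg p)
  have h2 : ‖p‖ ≤ ⌊‖p‖⌋₊ + 1 := (Nat.lt_floor_add_one _).le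
  rw [Prod.norm_def, Real.norm_eq_abs, Real.norm_eq_abs, le_max_iff, le_abs', le_abs'] at h1
  rw [Prod.norm_def, Real.norm_eq_abs, Real.norm_eq_abs, max_le_iff, abs_le, abs_le] at h2
  rw [← Real.norm_eq_abs, ← Real.norm_eq_abs, ← Prod.norm_def] at h1 h2
  set k := ⌊‖p‖⌋₊
  rw [mem_threeSides_iff, mem_leftSide]
  rcases le_total p.1 (-k) with h | h
  · exact Or.inr ⟨⟨h2.1.1, h⟩, h2.2⟩
  · by_cases hk : (k : ℝ) ≤ p.1 ∨ (k : ℝ) ≤ p.2 ∨ p.2 ≤ -k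
    · exact Or.inl ⟨⟨h, h2.1.2⟩, h2.2, hk⟩
    · have : p.1 ≤ -k := by tauto
      exact Or.inr ⟨⟨h2.1.1, this⟩, h2.2⟩

theorem shell_adjacent (hk : k ≤ ‖p‖ ∧ ‖p‖ ≤ k + 1) (hl : l ≤ ‖p‖ ∧ ‖p‖ ≤ l + 1) :
    k ≤ l + 1 ∧ l ≤ k + 1 := by
  constructor
  · exact_mod_cast hk.1.trans hl.2
  · exact_mod_cast hl.1.trans hk.2

/-- Distinct shells share only points whose sup norm is an integer, and that norm is the absolute
value of one coordinate. -/
theorem exists_int_of_shells (hk : k ≤ ‖p‖ ∧ ‖p‖ ≤ k + 1) (hl : l ≤ ‖p‖ ∧ ‖p‖ ≤ l + 1)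
    (hkl : k ≠ l) : ∃ n : ℤ, p.1 = n ∨ p.2 = n := by
  obtain ⟨h1, h2⟩ := shell_adjacent hk hl
  obtain ⟨n, hn⟩ : ∃ n : ℕ, ‖p‖ = n := by
    rcases lt_or_gt_of_ne hkl with h | h
    · obtain rfl : l = k + 1 := by omega
      exact ⟨k + 1, le_antisymm (by exact_mod_cast hk.2) hl.1⟩
    · obtain rfl : k = l + 1 := by omega
      exact ⟨l + 1, le_antisymm (by exact_mod_cast hl.2) hk.1⟩
  rw [Prod.norm_def, Real.norm_eq_abs, Real.norm_eq_abs] at hn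
  rcases max_choice |p.1| |p.2| with h | h <;> rw [h] at hn
  · rcases eq_or_eq_neg_of_abs_eq hn with h | h
    exacts [⟨n, Or.inl (by simpa using h)⟩, ⟨-n, Or.inl (by simpa using h)⟩]
  · rcases eq_or_eq_neg_of_abs_eq hn with h | h
    exacts [⟨n, Or.inr (by simpa using h)⟩, ⟨-n, Or.inr (by simpa using h)⟩]

/-! The regions of the plane that satisfy the formula. -/

/-- The value of `r'ᵢ`; `leftRegion i` will be that of `dᵢ`. -/
def threeRegion (i : ℕ) : RC (ℝ × ℝ) :=
  RC.everyFourth threeSides (fun _ _ h => (norm_of_mem_threeSides h).1) i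

def leftRegion (i : ℕ) : RC (ℝ × ℝ) :=
  RC.everyFourth leftSide (fun _ _ h => (norm_of_mem_leftSide h).1) i

def leftUpperRegion (i : ℕ) : RC (ℝ × ℝ) :=
  RC.everyFourth leftUpper (fun _ _ h => (norm_of_mem_leftSide (leftUpper_subset h)).1) i

def leftLowerRegion (i : ℕ) : RC (ℝ × ℝ) :=
  RC.everyFourth leftLower (fun _ _ h => (norm_of_mem_leftSide (leftLower_subset h)).1) i

def topRegion (i : ℕ) : RC (ℝ × ℝ) :=
  RC.everyFourth topSide (fun _ _ h => (norm_of_mem_topSide h).1) i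

def bottomRegion (i : ℕ) : RC (ℝ × ℝ) :=
  RC.everyFourth bottomSide (fun _ _ h => (norm_of_mem_bottomSide h).1) i

/-- The value of `t`: it crosses every left side and misses all the other sides. `rightHalf`, the
value of `s`, plays the opposite role. The upper and lower pieces below join one class of shells
above the axis and the opposite class below it. -/
def leftStrip : RC (ℝ × ℝ) :=
  (RC.Iic (-1)).prod (RC.Icc (show (-1 / 2 : ℝ) < 1 / 2 by norm_num))

def leftStripUpper : RC (ℝ × ℝ) :=
  (RC.Iic (-1)).prod (RC.Icc (show (1 / 4 : ℝ) < 1 / 2 by norm_num))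

def leftStripLower : RC (ℝ × ℝ) :=
  (RC.Iic (-1)).prod (RC.Icc (show (-1 / 2 : ℝ) < -1 / 4 by norm_num))

def rightHalf : RC (ℝ × ℝ) := (RC.Ici 1).prod ⊤

def rightUpper : RC (ℝ × ℝ) := (RC.Ici 1).prod (RC.Ici 1)

def rightLower : RC (ℝ × ℝ) := (RC.Ici 1).prod (RC.Iic (-1))

theorem mem_leftStrip : p ∈ leftStrip.carrier ↔ p.1 ≤ -1 ∧ -1 / 2 ≤ p.2 ∧ p.2 ≤ 1 / 2 := Iff.rfl

theorem mem_leftStripUpper :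
    p ∈ leftStripUpper.carrier ↔ p.1 ≤ -1 ∧ 1 / 4 ≤ p.2 ∧ p.2 ≤ 1 / 2 := Iff.rfl

theorem mem_leftStripLower :
    p ∈ leftStripLower.carrier ↔ p.1 ≤ -1 ∧ -1 / 2 ≤ p.2 ∧ p.2 ≤ -1 / 4 := Iff.rfl

theorem mem_rightHalf : p ∈ rightHalf.carrier ↔ 1 ≤ p.1 :=
  ⟨fun h => h.1, fun h => ⟨h, mem_univ _⟩⟩

theorem mem_rightUpper : p ∈ rightUpper.carrier ↔ 1 ≤ p.1 ∧ 1 ≤ p.2 := Iff.rfl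

theorem mem_rightLower : p ∈ rightLower.carrier ↔ 1 ≤ p.1 ∧ p.2 ≤ -1 := Iff.rfl

/-! ### Disjointness -/

/-- The source of the walk's direction: `threeSides k` has first coordinate at least `-k`, so it
touches the left side of its own shell and of the next inner one, never of the next outer one. -/
theorem index_of_mem_threeSides_of_mem_leftSide (hk : p ∈ (threeSides k).carrier)
    (hl : p ∈ (leftSide l).carrier) : l ≤ k ∧ k ≤ l + 1 := by
  obtain ⟨h1, h2⟩ := shell_adjacent (norm_of_mem_threeSides hk) (norm_of_mem_leftSide hl)
  refine ⟨?_, h1⟩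
  have h : (l : ℝ) ≤ k := by linarith [(mem_threeSides_iff.1 hk).1.1, (mem_leftSide.1 hl).1.2]
  exact_mod_cast h

theorem disjoint_threeRegion_leftRegion (h : (i + 1) % 4 = j % 4 ∨ (i + 2) % 4 = j % 4) :
    Disjoint (threeRegion i).carrier (leftRegion j).carrier := by
  rw [disjoint_left]
  intro p hp hp'
  obtain ⟨m, hm⟩ := RC.mem_everyFourth.1 hp
  obtain ⟨n, hn⟩ := RC.mem_everyFourth.1 hp'
  have := index_of_mem_threeSides_of_mem_leftSide hm hn
  omega

theorem disjoint_everyFourth {a b : ℕ → RC (ℝ × ℝ)} {ha hb}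
    (ha' : ∀ k, ∀ p ∈ (a k).carrier, k ≤ ‖p‖ ∧ ‖p‖ ≤ k + 1)
    (hb' : ∀ k, ∀ p ∈ (b k).carrier, k ≤ ‖p‖ ∧ ‖p‖ ≤ k + 1) (h : (i + 2) % 4 = j % 4) :
    Disjoint (RC.everyFourth a ha i).carrier (RC.everyFourth b hb j).carrier := by
  rw [disjoint_left]
  intro p hp hp'
  obtain ⟨m, hm⟩ := RC.mem_everyFourth.1 hp
  obtain ⟨n, hn⟩ := RC.mem_everyFourth.1 hp'
  have := shell_adjacent (ha' _ _ hm) (hb' _ _ hn)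
  omega

theorem RC.disjoint_everyFourth_left {a : ℕ → RC (ℝ × ℝ)} {ha} {B : Set (ℝ × ℝ)}
    (h : ∀ k, ∀ p ∈ (a k).carrier, p ∉ B) : Disjoint (RC.everyFourth a ha i).carrier B := by
  rw [disjoint_left]
  intro p hp
  obtain ⟨m, hm⟩ := RC.mem_everyFourth.1 hp
  exact h _ _ hm

theorem notMem_leftStrip_of_mem_threeSides (h : p ∈ (threeSides k).carrier) :
    p ∉ leftStrip.carrier := by
  rw [mem_threeSides_iff] at h
  rw [mem_leftStrip]
  rintro ⟨h1, h2, h3⟩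
  obtain ⟨h4, -, h5⟩ := h
  have hk : (1 : ℝ) ≤ k := by linarith
  rcases h5 with h | h | h <;> linarith

theorem notMem_rightHalf_of_mem_leftSide (h : p ∈ (leftSide k).carrier) :
    p ∉ rightHalf.carrier := by
  rw [mem_leftSide] at h
  rw [mem_rightHalf]
  have := k.cast_nonneg (α := ℝ)
  intro h'
  linarith [h.1.2]

theorem disjoint_leftStrip_rightHalf : Disjoint leftStrip.carrier rightHalf.carrier := by
  rw [disjoint_left]
  intro p hp hp'
  rw [mem_leftStrip] at hp
  rw [mem_rightHalf] at hp'
  linarith [hp.1]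

theorem disjoint_threeRegion_sup_leftRegion_sup
    (h : (i + 1) % 4 = j % 4 ∨ (i + 2) % 4 = j % 4) :
    Disjoint (threeRegion i ⊔ rightHalf).carrier (leftRegion j ⊔ leftStrip).carrier := by
  rw [RC.sup_carrier, RC.sup_carrier, disjoint_union_left, disjoint_union_right,
    disjoint_union_right]
  exact ⟨⟨disjoint_threeRegion_leftRegion h,
    RC.disjoint_everyFourth_left fun k p hp => notMem_leftStrip_of_mem_threeSides hp⟩,
    (RC.disjoint_everyFourth_left fun k p hp => notMem_rightHalf_of_mem_leftSide hp).symm,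
    disjoint_leftStrip_rightHalf.symm⟩

theorem leftStripUpper_subset : leftStripUpper.carrier ⊆ leftStrip.carrier := by
  intro p hp
  rw [mem_leftStripUpper] at hp
  exact ⟨hp.1, by linarith [hp.2.1], hp.2.2⟩

theorem leftStripLower_subset : leftStripLower.carrier ⊆ leftStrip.carrier := by
  intro p hp
  rw [mem_leftStripLower] at hp
  exact ⟨hp.1, hp.2.1, by linarith [hp.2.2]⟩

/-- Pieces from shells in opposite classes are never adjacent, and the strips are kept apart by the
gap `|y| < 1 / 4`. -/
theorem disjoint_threeRegions_joined_left (h : (i + 2) % 4 = j % 4) :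
    Disjoint (threeRegion i ⊔ (leftUpperRegion i ⊔ leftStripUpper)).carrier
      (threeRegion j ⊔ (leftLowerRegion j ⊔ leftStripLower)).carrier := by
  have h' : (j + 2) % 4 = i % 4 := by omega
  have hU : ∀ k, ∀ p ∈ (threeSides k).carrier, (k : ℝ) ≤ ‖p‖ ∧ ‖p‖ ≤ k + 1 :=
    fun _ _ h => norm_of_mem_threeSides h
  have hu : ∀ k, ∀ p ∈ (leftUpper k).carrier, (k : ℝ) ≤ ‖p‖ ∧ ‖p‖ ≤ k + 1 :=
    fun _ _ h => norm_of_mem_leftSide (leftUpper_subset h)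
  have hl : ∀ k, ∀ p ∈ (leftLower k).carrier, (k : ℝ) ≤ ‖p‖ ∧ ‖p‖ ≤ k + 1 :=
    fun _ _ h => norm_of_mem_leftSide (leftLower_subset h)
  simp only [RC.sup_carrier, disjoint_union_left, disjoint_union_right]
  refine ⟨⟨disjoint_everyFourth hU hU h, disjoint_everyFourth hu hU h, ?_⟩,
    ⟨disjoint_everyFourth hU hl h, disjoint_everyFourth hu hl h, ?_⟩, ?_, ?_, ?_⟩
  · exact (RC.disjoint_everyFourth_left fun k p hp hp' =>
      notMem_leftStrip_of_mem_threeSides hp (leftStripUpper_subset hp')).symm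
  · refine (RC.disjoint_everyFourth_left fun k p hp hp' => ?_).symm
    rw [mem_leftLower] at hp
    rw [mem_leftStripUpper] at hp'
    linarith [hp.2.2, hp'.2.1]
  · exact RC.disjoint_everyFourth_left fun k p hp hp' =>
      notMem_leftStrip_of_mem_threeSides hp (leftStripLower_subset hp')
  · refine RC.disjoint_everyFourth_left fun k p hp hp' => ?_
    rw [mem_leftUpper] at hp
    rw [mem_leftStripLower] at hp'
    linarith [hp.2.1, hp'.2.2]
  · rw [disjoint_left]
    intro p hp hp'
    rw [mem_leftStripUpper] at hp
    rw [mem_leftStripLower] at hp'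
    linarith [hp.2.1, hp'.2.2]

theorem rightUpper_subset : rightUpper.carrier ⊆ rightHalf.carrier :=
  fun _ hp => mem_rightHalf.2 hp.1

theorem rightLower_subset : rightLower.carrier ⊆ rightHalf.carrier :=
  fun _ hp => mem_rightHalf.2 hp.1

theorem disjoint_leftRegions_joined_right (h : (i + 2) % 4 = j % 4) :
    Disjoint (leftRegion i ⊔ (topRegion i ⊔ rightUpper)).carrier
      (leftRegion j ⊔ (bottomRegion j ⊔ rightLower)).carrier := by
  have hL : ∀ k, ∀ p ∈ (leftSide k).carrier, (k : ℝ) ≤ ‖p‖ ∧ ‖p‖ ≤ k + 1 :=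
    fun _ _ h => norm_of_mem_leftSide h
  have ht : ∀ k, ∀ p ∈ (topSide k).carrier, (k : ℝ) ≤ ‖p‖ ∧ ‖p‖ ≤ k + 1 :=
    fun _ _ h => norm_of_mem_topSide h
  have hb : ∀ k, ∀ p ∈ (bottomSide k).carrier, (k : ℝ) ≤ ‖p‖ ∧ ‖p‖ ≤ k + 1 :=
    fun _ _ h => norm_of_mem_bottomSide h
  simp only [RC.sup_carrier, disjoint_union_left, disjoint_union_right]
  refine ⟨⟨disjoint_everyFourth hL hL h, disjoint_everyFourth ht hL h, ?_⟩,
    ⟨disjoint_everyFourth hL hb h, disjoint_everyFourth ht hb h, ?_⟩, ?_, ?_, ?_⟩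
  · exact (RC.disjoint_everyFourth_left fun k p hp hp' =>
      notMem_rightHalf_of_mem_leftSide hp (rightUpper_subset hp')).symm
  · refine (RC.disjoint_everyFourth_left fun k p hp hp' => ?_).symm
    rw [mem_bottomSide] at hp
    rw [mem_rightUpper] at hp'
    linarith [hp.2.2, hp'.2, k.cast_nonneg (α := ℝ)]
  · exact RC.disjoint_everyFourth_left fun k p hp hp' =>
      notMem_rightHalf_of_mem_leftSide hp (rightLower_subset hp')
  · refine RC.disjoint_everyFourth_left fun k p hp hp' => ?_
    rw [mem_topSide] at hp
    rw [mem_rightLower] at hp'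
    linarith [hp.2.1, hp'.2, k.cast_nonneg (α := ℝ)]
  · rw [disjoint_left]
    intro p hp hp'
    rw [mem_rightUpper] at hp
    rw [mem_rightLower] at hp'
    linarith [hp.2, hp'.2]

/-! ### Connectedness -/

theorem isPreconnected_leftSide : IsPreconnected (leftSide k).carrier :=
  isPreconnected_Icc.prod isPreconnected_Icc

theorem isPreconnected_topSide : IsPreconnected (topSide k).carrier :=
  isPreconnected_Icc.prod isPreconnected_Icc

theorem isPreconnected_bottomSide : IsPreconnected (bottomSide k).carrier :=
  isPreconnected_Icc.prod isPreconnected_Icc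

theorem isPreconnected_leftUpper : IsPreconnected (leftUpper k).carrier :=
  isPreconnected_Icc.prod isPreconnected_Icc

theorem isPreconnected_leftLower : IsPreconnected (leftLower k).carrier :=
  isPreconnected_Icc.prod isPreconnected_Icc

theorem isPreconnected_threeSides : IsPreconnected (threeSides k).carrier := by
  have := k.cast_nonneg (α := ℝ)
  have hr : IsPreconnected (rightSide k).carrier := isPreconnected_Icc.prod isPreconnected_Icc
  refine (isPreconnected_topSide.union' ⟨((k + 1 : ℝ), (k + 1 : ℝ)), ?_, ?_⟩ hr).union'
    ⟨((k + 1 : ℝ), -(k + 1 : ℝ)), Or.inr ?_, ?_⟩ isPreconnected_bottomSide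
  · rw [mem_topSide]; constructor <;> constructor <;> dsimp <;> linarith
  · rw [mem_rightSide]; constructor <;> constructor <;> dsimp <;> linarith
  · rw [mem_rightSide]; constructor <;> constructor <;> dsimp <;> linarith
  · rw [mem_bottomSide]; constructor <;> constructor <;> dsimp <;> linarith

theorem isPreconnected_leftStrip : IsPreconnected leftStrip.carrier :=
  isPreconnected_Iic.prod isPreconnected_Icc

theorem isPreconnected_rightHalf : IsPreconnected rightHalf.carrier :=
  isPreconnected_Ici.prod isPreconnected_univ

theorem topCorner_mem_leftSide : ((-k : ℝ), (k + 1 : ℝ)) ∈ (leftSide k).carrier := by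
  have := k.cast_nonneg (α := ℝ)
  rw [mem_leftSide]; constructor <;> constructor <;> dsimp <;> linarith

theorem topCorner_mem_leftUpper : ((-k : ℝ), (k + 1 : ℝ)) ∈ (leftUpper k).carrier := by
  have := k.cast_nonneg (α := ℝ)
  rw [mem_leftUpper]; constructor <;> constructor <;> dsimp <;> linarith

theorem topCorner_mem_topSide : ((-k : ℝ), (k + 1 : ℝ)) ∈ (topSide k).carrier := by
  have := k.cast_nonneg (α := ℝ)
  rw [mem_topSide]; constructor <;> constructor <;> dsimp <;> linarith

theorem bottomCorner_mem_leftSide : ((-k : ℝ), -(k + 1 : ℝ)) ∈ (leftSide k).carrier := by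
  have := k.cast_nonneg (α := ℝ)
  rw [mem_leftSide]; constructor <;> constructor <;> dsimp <;> linarith

theorem bottomCorner_mem_leftLower : ((-k : ℝ), -(k + 1 : ℝ)) ∈ (leftLower k).carrier := by
  have := k.cast_nonneg (α := ℝ)
  rw [mem_leftLower]; constructor <;> constructor <;> dsimp <;> linarith

theorem bottomCorner_mem_bottomSide : ((-k : ℝ), -(k + 1 : ℝ)) ∈ (bottomSide k).carrier := by
  have := k.cast_nonneg (α := ℝ)
  rw [mem_bottomSide]; constructor <;> constructor <;> dsimp <;> linarith

theorem axis_mem_threeSides : ((k + 1 : ℝ), (0 : ℝ)) ∈ (threeSides k).carrier := by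
  have := k.cast_nonneg (α := ℝ)
  refine Or.inl (Or.inr ?_)
  rw [mem_rightSide]; constructor <;> constructor <;> dsimp <;> linarith

theorem axis_mem_threeSides_succ : ((k + 1 : ℝ), (0 : ℝ)) ∈ (threeSides (k + 1)).carrier := by
  have := k.cast_nonneg (α := ℝ)
  refine Or.inl (Or.inr ?_)
  rw [mem_rightSide]; push_cast; constructor <;> constructor <;> linarith

theorem axis_mem_rightHalf : ((k + 1 : ℝ), (0 : ℝ)) ∈ rightHalf.carrier := by
  rw [mem_rightHalf]; simp

theorem isPreconnected_threeRegion_sup_rightHalf :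
    IsPreconnected (threeRegion i ⊔ rightHalf).carrier := by
  rw [sup_comm]
  exact isPreconnected_union_iUnion isPreconnected_rightHalf
    (fun m => isPreconnected_threeSides) fun m => ⟨_, axis_mem_threeSides, axis_mem_rightHalf⟩

theorem leftSide_inter_leftStrip : ((leftSide k).carrier ∩ leftStrip.carrier).Nonempty := by
  have := k.cast_nonneg (α := ℝ)
  refine ⟨(-(k + 1 : ℝ), (0 : ℝ)), ?_, ?_⟩
  · rw [mem_leftSide]; constructor <;> constructor <;> dsimp <;> linarith
  · rw [mem_leftStrip]; refine ⟨?_, ?_, ?_⟩ <;> dsimp <;> linarith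

theorem isPreconnected_leftRegion_sup_leftStrip :
    IsPreconnected (leftRegion i ⊔ leftStrip).carrier := by
  rw [sup_comm]
  exact isPreconnected_union_iUnion isPreconnected_leftStrip
    (fun m => isPreconnected_leftSide) fun m => leftSide_inter_leftStrip

/-- The common pattern of the joined regions: each `b k` is a bridge from `a k` to the connected set
`c`. -/
theorem isPreconnected_joined_union {a b : ℕ → RC (ℝ × ℝ)} {ha hb} {c : RC (ℝ × ℝ)}
    (hac : ∀ k, IsPreconnected (a k).carrier) (hbc : ∀ k, IsPreconnected (b k).carrier)
    (hc : IsPreconnected c.carrier) (hab : ∀ k, ((a k).carrier ∩ (b k).carrier).Nonempty)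
    (hb' : ∀ k, ((b k).carrier ∩ c.carrier).Nonempty) :
    IsPreconnected (RC.everyFourth a ha i ⊔ (RC.everyFourth b hb i ⊔ c)).carrier := by
  have e : (RC.everyFourth a ha i ⊔ (RC.everyFourth b hb i ⊔ c)).carrier =
      c.carrier ∪ ⋃ m, ((a (4 * m + i)).carrier ∪ (b (4 * m + i)).carrier) := by
    rw [iUnion_union_distrib, union_comm c.carrier, union_assoc]
    rfl
  rw [e]
  exact isPreconnected_union_iUnion hc (fun m => (hac _).union' (hab _) (hbc _))
    fun m => (hb' _).mono (inter_subset_inter_left _ subset_union_right)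

theorem isPreconnected_threeRegion_joined_upper :
    IsPreconnected (threeRegion i ⊔ (leftUpperRegion i ⊔ leftStripUpper)).carrier := by
  refine isPreconnected_joined_union (fun k => isPreconnected_threeSides)
    (fun k => isPreconnected_leftUpper) (isPreconnected_Iic.prod isPreconnected_Icc)
    (fun k => ⟨_, topSide_subset topCorner_mem_topSide, topCorner_mem_leftUpper⟩)
    fun k => ⟨(-(k + 1 : ℝ), (1 / 4 : ℝ)), ?_, ?_⟩ <;> have := k.cast_nonneg (α := ℝ)
  · rw [mem_leftUpper]; constructor <;> constructor <;> dsimp <;> linarith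
  · rw [mem_leftStripUpper]; refine ⟨?_, ?_, ?_⟩ <;> dsimp <;> linarith

theorem isPreconnected_threeRegion_joined_lower :
    IsPreconnected (threeRegion i ⊔ (leftLowerRegion i ⊔ leftStripLower)).carrier := by
  refine isPreconnected_joined_union (fun k => isPreconnected_threeSides)
    (fun k => isPreconnected_leftLower) (isPreconnected_Iic.prod isPreconnected_Icc)
    (fun k => ⟨_, bottomSide_subset bottomCorner_mem_bottomSide, bottomCorner_mem_leftLower⟩)
    fun k => ⟨(-(k + 1 : ℝ), (-1 / 4 : ℝ)), ?_, ?_⟩ <;> have := k.cast_nonneg (α := ℝ)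
  · rw [mem_leftLower]; constructor <;> constructor <;> dsimp <;> linarith
  · rw [mem_leftStripLower]; refine ⟨?_, ?_, ?_⟩ <;> dsimp <;> linarith

theorem isPreconnected_leftRegion_joined_upper :
    IsPreconnected (leftRegion i ⊔ (topRegion i ⊔ rightUpper)).carrier := by
  refine isPreconnected_joined_union (fun k => isPreconnected_leftSide)
    (fun k => isPreconnected_topSide) (isPreconnected_Ici.prod isPreconnected_Ici)
    (fun k => ⟨_, topCorner_mem_leftSide, topCorner_mem_topSide⟩)
    fun k => ⟨((k + 1 : ℝ), (k + 1 : ℝ)), ?_, ?_⟩ <;> have := k.cast_nonneg (α := ℝ)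
  · rw [mem_topSide]; constructor <;> constructor <;> dsimp <;> linarith
  · rw [mem_rightUpper]; constructor <;> dsimp <;> linarith

theorem isPreconnected_leftRegion_joined_lower :
    IsPreconnected (leftRegion i ⊔ (bottomRegion i ⊔ rightLower)).carrier := by
  refine isPreconnected_joined_union (fun k => isPreconnected_leftSide)
    (fun k => isPreconnected_bottomSide) (isPreconnected_Ici.prod isPreconnected_Iic)
    (fun k => ⟨_, bottomCorner_mem_leftSide, bottomCorner_mem_bottomSide⟩)
    fun k => ⟨((k + 1 : ℝ), -(k + 1 : ℝ)), ?_, ?_⟩ <;> have := k.cast_nonneg (α := ℝ)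
  · rw [mem_bottomSide]; constructor <;> constructor <;> dsimp <;> linarith
  · rw [mem_rightLower]; constructor <;> dsimp <;> linarith

/-- Full shells of class `j` are joined along `leftStrip`, and the three sides of each shell of
class `i` touch the next shell on the right-hand axis. The hypothesis says that the next shell is of
class `j`. -/
theorem isPreconnected_threeRegion_sup_next (h : ∀ m, ∃ m', 4 * m' + j = 4 * m + i + 1) :
    IsPreconnected (threeRegion i ⊔ (threeRegion j ⊔ leftRegion j) ⊔ leftStrip).carrier := by
  have h1 : IsPreconnected (threeRegion j ⊔ (leftRegion j ⊔ leftStrip)).carrier :=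
    isPreconnected_joined_union (fun k => isPreconnected_threeSides)
      (fun k => isPreconnected_leftSide) isPreconnected_leftStrip
      (fun k => ⟨_, topSide_subset topCorner_mem_topSide, topCorner_mem_leftSide⟩)
      fun k => leftSide_inter_leftStrip
  rw [sup_assoc, sup_comm, sup_assoc (threeRegion j)]
  refine isPreconnected_union_iUnion h1 (fun m => isPreconnected_threeSides) fun m => ?_
  obtain ⟨m', hm'⟩ := h m
  refine ⟨_, axis_mem_threeSides, Or.inl (RC.mem_everyFourth.2 ⟨m', ?_⟩)⟩
  rw [hm']
  exact axis_mem_threeSides_succ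

/-! ### The partition -/

theorem exists_mem_regions (p : ℝ × ℝ) :
    ∃ i < 4, p ∈ (threeRegion i).carrier ∨ p ∈ (leftRegion i).carrier := by
  obtain ⟨k, hk⟩ := exists_mem_shell p
  refine ⟨k % 4, Nat.mod_lt _ (by norm_num), hk.imp (fun h => ?_) fun h => ?_⟩
  all_goals
    refine RC.mem_everyFourth.2 ⟨k / 4, ?_⟩
    rwa [Nat.div_add_mod]

theorem norm_of_mem_region (h : p ∈ (threeRegion i ⊔ leftRegion i).carrier) :
    ∃ m : ℕ, ((4 * m + i : ℕ) : ℝ) ≤ ‖p‖ ∧ ‖p‖ ≤ (4 * m + i : ℕ) + 1 := by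
  rcases h with h | h
  all_goals obtain ⟨m, hm⟩ := RC.mem_everyFourth.1 h
  exacts [⟨m, norm_of_mem_threeSides hm⟩, ⟨m, norm_of_mem_leftSide hm⟩]

theorem region_inf_region (h : i % 4 ≠ j % 4) :
    (threeRegion i ⊔ leftRegion i) ⊓ (threeRegion j ⊔ leftRegion j) = ⊥ := by
  refine RC.inf_eq_bot_of_generic fun p hp hp' => ?_
  obtain ⟨m, hm⟩ := norm_of_mem_region hp
  obtain ⟨n, hn⟩ := norm_of_mem_region hp'
  exact exists_int_of_shells hm hn (by omega)

theorem threeRegion_inf_leftRegion : threeRegion i ⊓ leftRegion i = ⊥ := by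
  refine RC.inf_eq_bot_of_generic fun p hp hp' => ?_
  obtain ⟨m, hm⟩ := RC.mem_everyFourth.1 hp
  obtain ⟨n, hn⟩ := RC.mem_everyFourth.1 hp'
  by_cases hmn : 4 * m + i = 4 * n + i
  · rw [hmn] at hm
    have h1 := (mem_threeSides_iff.1 hm).1.1
    have h2 := (mem_leftSide.1 hn).1.2
    exact ⟨-((4 * n + i : ℕ) : ℤ), Or.inl (by push_cast at *; linarith)⟩
  · exact exists_int_of_shells (norm_of_mem_threeSides hm) (norm_of_mem_leftSide hn) hmn

theorem threeRegion_nonempty : (threeRegion i).carrier.Nonempty :=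
  ⟨_, RC.mem_everyFourth.2 ⟨0, axis_mem_threeSides⟩⟩

theorem rightHalf_subset : rightHalf.carrier ⊆
    (threeRegion 0 ⊔ threeRegion 1 ⊔ threeRegion 2 ⊔ threeRegion 3).carrier := by
  intro p hp
  obtain ⟨i, hi, h | h⟩ := exists_mem_regions p
  · interval_cases i
    exacts [Or.inl (Or.inl (Or.inl h)), Or.inl (Or.inl (Or.inr h)), Or.inl (Or.inr h), Or.inr h]
  · obtain ⟨m, hm⟩ := RC.mem_everyFourth.1 h
    exact absurd hp (notMem_rightHalf_of_mem_leftSide hm)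

theorem isPreconnected_sum_threeRegion : IsPreconnected
    (threeRegion 0 ⊔ threeRegion 1 ⊔ threeRegion 2 ⊔ threeRegion 3).carrier := by
  -- No left side reaches `rightHalf`, so the sum already contains it, and adding it to each summand
  -- makes all four connected with a common point.
  have e : threeRegion 0 ⊔ threeRegion 1 ⊔ threeRegion 2 ⊔ threeRegion 3 =
      (threeRegion 0 ⊔ rightHalf) ⊔ (threeRegion 1 ⊔ rightHalf) ⊔ (threeRegion 2 ⊔ rightHalf) ⊔
        (threeRegion 3 ⊔ rightHalf) := by
    have : rightHalf ≤ threeRegion 0 ⊔ threeRegion 1 ⊔ threeRegion 2 ⊔ threeRegion 3 :=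
      rightHalf_subset
    rw [← sup_sup_distrib_right, ← sup_sup_distrib_right, ← sup_sup_distrib_right,
      sup_eq_left.2 this]
  have hx : ∀ i, ((1 : ℝ), (0 : ℝ)) ∈ (threeRegion i ⊔ rightHalf).carrier := fun i =>
    Or.inr (mem_rightHalf.2 le_rfl)
  have hc := fun i => isPreconnected_threeRegion_sup_rightHalf (i := i)
  rw [e]
  exact (((hc 0).union (1, 0) (hx 0) (hx 1) (hc 1)).union (1, 0) (Or.inl (hx 0)) (hx 2)
    (hc 2)).union (1, 0) (Or.inl (Or.inl (hx 0))) (hx 3) (hc 3)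

/-! ### The assignment -/

/-- The assignment of plane regions that satisfies the formula. -/
def planeAssignment (v : ℕ) : RC (ℝ × ℝ) :=
  if v < 4 then threeRegion v ⊔ leftRegion v
  else if v < 8 then threeRegion (v - 4)
  else if v = 8 then leftStrip
  else if v = 9 then rightHalf
  else if v < 12 then leftUpperRegion (v - 10) ⊔ leftStripUpper
  else if v < 14 then leftLowerRegion (v - 10) ⊔ leftStripLower
  else if v < 16 then topRegion (v - 14) ⊔ rightUpper
  else bottomRegion (v - 14) ⊔ rightLower

theorem eval_r (i : Fin 4) :
    (r i).eval planeAssignment = threeRegion i.val ⊔ leftRegion i.val := by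
  fin_cases i <;> rfl

theorem eval_r' (i : Fin 4) : (r' i).eval planeAssignment = threeRegion i.val := by
  fin_cases i <;> rfl

/-- The two parts of `rᵢ` have zero product, so removing the three sides leaves exactly the left
sides. -/
theorem eval_d (i : Fin 4) : (d i).eval planeAssignment = leftRegion i.val := by
  change (r i).eval planeAssignment ⊓ ((r' i).eval planeAssignment)ᶜ = _
  rw [eval_r, eval_r', ← _root_.sdiff_eq]
  exact (disjoint_iff.2 threeRegion_inf_leftRegion).sup_sdiff_cancel_left

theorem RC.NotConn.symm {T : Type*} [TopologicalSpace T] {a b : RC T} (h : a.NotConn b) :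
    b.NotConn a := ⟨h.2.1, h.1, sup_comm a b ▸ h.2.2⟩

theorem leftStrip_nonempty : leftStrip.carrier.Nonempty :=
  (leftSide_inter_leftStrip (k := 0)).mono inter_subset_right

theorem notConn_threeRegion_leftRegion (h : (i + 1) % 4 = j % 4 ∨ (i + 2) % 4 = j % 4) :
    (threeRegion i ⊔ rightHalf).NotConn (leftRegion j ⊔ leftStrip) :=
  .of_disjoint isPreconnected_threeRegion_sup_rightHalf isPreconnected_leftRegion_sup_leftStrip
    (threeRegion_nonempty.mono subset_union_left)
    (leftStrip_nonempty.mono subset_union_right)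
    (disjoint_threeRegion_sup_leftRegion_sup h)

theorem leftRegion_nonempty : (leftRegion i).carrier.Nonempty :=
  ⟨_, RC.mem_everyFourth.2 ⟨0, topCorner_mem_leftSide⟩⟩

theorem notConn_threeRegions (h : (i + 2) % 4 = j % 4) :
    (threeRegion i ⊔ (leftUpperRegion i ⊔ leftStripUpper)).NotConn
      (threeRegion j ⊔ (leftLowerRegion j ⊔ leftStripLower)) :=
  .of_disjoint isPreconnected_threeRegion_joined_upper isPreconnected_threeRegion_joined_lower
    (threeRegion_nonempty.mono subset_union_left) (threeRegion_nonempty.mono subset_union_left)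
    (disjoint_threeRegions_joined_left h)

theorem notConn_leftRegions (h : (i + 2) % 4 = j % 4) :
    (leftRegion i ⊔ (topRegion i ⊔ rightUpper)).NotConn
      (leftRegion j ⊔ (bottomRegion j ⊔ rightLower)) :=
  .of_disjoint isPreconnected_leftRegion_joined_upper isPreconnected_leftRegion_joined_lower
    (leftRegion_nonempty.mono subset_union_left) (leftRegion_nonempty.mono subset_union_left)
    (disjoint_leftRegions_joined_right h)

theorem eval_sum_r : (r 0).eval planeAssignment ⊔ (r 1).eval planeAssignment ⊔
    (r 2).eval planeAssignment ⊔ (r 3).eval planeAssignment = ⊤ := by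
  refine RC.ext (eq_univ_of_forall fun p => ?_)
  simp only [eval_r]
  obtain ⟨i, hi, h⟩ := exists_mem_regions p
  interval_cases i
  exacts [Or.inl (Or.inl (Or.inl h)), Or.inl (Or.inl (Or.inr h)), Or.inl (Or.inr h), Or.inr h]

theorem eval_r_inf_eval_r {i j : Fin 4} (h : i ≠ j) :
    (r i).eval planeAssignment ⊓ (r j).eval planeAssignment = ⊥ := by
  rw [eval_r, eval_r]
  exact region_inf_region (by omega)

/-- The case `i + 1` is the step condition of the formula; the case `i + 2` gives the mixed
conditions in `separationPart`, one of them by symmetry. -/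
theorem notConn_eval_r'_eval_d {i j : Fin 4} (h : i + 1 = j ∨ i + 2 = j) :
    RC.NotConn ((r' i).eval planeAssignment ⊔ planeAssignment 9)
      ((d j).eval planeAssignment ⊔ planeAssignment 8) := by
  rw [eval_r', eval_d]
  refine notConn_threeRegion_leftRegion (h.imp ?_ ?_) <;>
  · rintro rfl
    rw [Fin.val_add]
    simp

theorem separationPart_zero_holds : (separationPart 0).Holds planeAssignment := by
  rw [separationPart_holds_iff]
  refine ⟨?_, ?_, (notConn_eval_r'_eval_d (by decide)).symm, notConn_eval_r'_eval_d (by decide)⟩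
  · rw [eval_r', eval_r']
    exact notConn_threeRegions (i := 0) (j := 2) rfl
  · rw [eval_d, eval_d]
    exact notConn_leftRegions (i := 0) (j := 2) rfl

theorem separationPart_one_holds : (separationPart 1).Holds planeAssignment := by
  rw [separationPart_holds_iff]
  refine ⟨?_, ?_, (notConn_eval_r'_eval_d (by decide)).symm, notConn_eval_r'_eval_d (by decide)⟩
  · rw [eval_r', eval_r']
    exact notConn_threeRegions (i := 1) (j := 3) rfl
  · rw [eval_d, eval_d]
    exact notConn_leftRegions (i := 1) (j := 3) rfl

theorem isPreconnected_eval_r'_sup_eval_r (i : Fin 4) :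
    IsPreconnected ((r' i).eval planeAssignment ⊔ (r (i + 1)).eval planeAssignment ⊔
      planeAssignment 8).carrier := by
  rw [eval_r', eval_r]
  refine isPreconnected_threeRegion_sup_next fun m => ?_
  -- After class 3 the numbering wraps round to class 0 of the next block of four shells.
  by_cases hi : i.val = 3
  · exact ⟨m + 1, by rw [Fin.val_add]; simp [hi]; omega⟩
  · exact ⟨m, by rw [Fin.val_add]; simp; omega⟩

theorem notConn_sum_eval_r' :
    RC.NotConn ((r' 0).eval planeAssignment ⊔ (r' 1).eval planeAssignment ⊔
      (r' 2).eval planeAssignment ⊔ (r' 3).eval planeAssignment) (planeAssignment 8) := by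
  have h : ∀ i, Disjoint (threeRegion i).carrier leftStrip.carrier := fun i =>
    RC.disjoint_everyFourth_left fun k p hp => notMem_leftStrip_of_mem_threeSides hp
  simp only [eval_r']
  exact .of_disjoint isPreconnected_sum_threeRegion isPreconnected_leftStrip
    (threeRegion_nonempty.mono subset_union_right) leftStrip_nonempty
    ((((h 0).union_left (h 1)).union_left (h 2)).union_left (h 3))

theorem phiInfty_holds_planeAssignment : phiInfty.Holds planeAssignment := by
  rw [phiInfty_holds_iff]
  refine ⟨⟨eval_sum_r, eval_r_inf_eval_r (by decide), eval_r_inf_eval_r (by decide),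
    eval_r_inf_eval_r (by decide), eval_r_inf_eval_r (by decide), eval_r_inf_eval_r (by decide),
    eval_r_inf_eval_r (by decide), fun i => ?_⟩, separationPart_zero_holds,
    separationPart_one_holds, fun i => ?_, RC.ne_bot_iff.2 leftStrip_nonempty,
    isPreconnected_eval_r'_sup_eval_r, notConn_sum_eval_r',
    fun i => notConn_eval_r'_eval_d (Or.inl rfl)⟩
  · rw [eval_r]
    exact RC.ne_bot_iff.2 (threeRegion_nonempty.mono subset_union_left)
  · rw [eval_r, eval_r']
    exact ⟨RC.ne_bot_iff.2 threeRegion_nonempty, inf_eq_left.2 le_sup_left⟩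

end Plane

end BcLogic

theorem mainTheorem9 :
    (∀ n : ℕ, 2 ≤ n →
      BcLogic.phiInfty ∈
        BcLogic.Sat (⊤ : BooleanSubalgebra (BcLogic.RC (EuclideanSpace ℝ (Fin n))))) ∧
    (∀ (T : Type*) [TopologicalSpace T] [LocallyConnectedSpace T], BcLogic.Unicoherent T →
      ∀ I : ℕ → BcLogic.RC T, BcLogic.phiInfty.Holds I →
        ∃ v ∈ BcLogic.phiInfty.vars, Infinite (ConnectedComponents (I v).carrier)) ∧
    (∀ n : ℕ, 2 ≤ n →
      BcLogic.Sat (⊤ : BooleanSubalgebra (BcLogic.RC (EuclideanSpace ℝ (Fin n)))) ≠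
        BcLogic.Sat (BcLogic.RCP n)) := by
  have ha : ∀ n : ℕ, 2 ≤ n → BcLogic.phiInfty ∈
      BcLogic.Sat (⊤ : BooleanSubalgebra (BcLogic.RC (EuclideanSpace ℝ (Fin n)))) :=
    fun n hn => BcLogic.phiInfty_mem_sat_of_plane BcLogic.phiInfty_holds_planeAssignment hn
  exact ⟨ha, fun T _ _ hT I hI => BcLogic.exists_infinite_of_holds hT I hI,
    fun n hn h => BcLogic.phiInfty_notMem_sat_RCP n (h ▸ ha n hn)⟩
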